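/- **Setting.** Let $H$ be a real Hilbert space with inner product $\langle\cdot,\cdot\rangle$ (for example $L^2(\mathbb R^N;\mathbb R^K)$), and let $V$ be a real Hilbert space densely and continuously embedded in $H$, with dual $V'\supseteq H$ (for example $V=H^1$). Let the acceleration operator $\mathbf M:V\to V'$ be a Hermitian, positive-definite topological isomorphism, so that $V$ is its energy space. Let $\mathbf L_{00}:V\to V'$ be a (nonlinear) operator and let $u\in V$, $\mu\in\mathbb R$ satisfy $\mathbf L_0u:=\mathbf L_{00}u-\mu u=0$, where $\mathbf L_{00}$ is twice continuously differentiable near $u$. Let $\mathbf L_1:V\to V'$ be the Fréchet derivative of $\mathbf L_0$ with respect to $u$, and $\mathbf L_1^\dagger:V\to V'$ its adjoint, $\langle \mathbf L_1^\dagger\varphi,\psi\rangle=\langle \mathbf L_1\psi,\varphi\rangle$. The iteration SOMI with time step $\Delta t$ is $$u_{n+1}=u_n-\left[\mathbf M^{-1}\mathbf L_1^\dagger\mathbf M^{-1}\mathbf L_0u\right]_{u=u_n,\,\mu=\mu_n}\Delta t,\qquad \mu_{n+1}=\mu_n+\langle u,\mathbf M^{-1}\mathbf L_0u\rangle\big|_{u=u_n,\,\mu=\mu_n}\,\Delta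 t .$$ With $\mathbf L_1$ taken at the solution $(u,\mu)$, the augmented linearized operator on $V\times\mathbb R$ is $$\mathcal L_I\begin{pmatrix}\tilde u\\ \tilde\mu\end{pmatrix}=\begin{pmatrix}-\mathbf M^{-1}\mathbf L_1^\dagger\mathbf M^{-1}(\mathbf L_1\tilde u-\tilde\mu u)\\ \langle u,\mathbf M^{-1}(\mathbf L_1\tilde u-\tilde\mu u)\rangle\end{pmatrix}.$$ **Assumptions.** (1) There is a family $U(c)$, $c=(c_1,\dots,c_s)\in\mathbb R^s$ ($s\ge 0$), continuously differentiable near some $c^0$, of solutions of $\mathbf L_{00}U(c)-\mu U(c)=0$ ($c$ near $c^0$) with $U(c^0)=u$, and the kernel of $\mathbf L_1$ is spanned by the invariance modes $\partial U/\partial c_j(c^0)$, $1\le j\le s$. (2) $u$ is not orthogonal to $\ker\mathbf L_1^\dagger$. **Claim.** The equation $\mathbf L_1F=u$ has no solution $F\in V$. The spectrum of $\mathcal L_I$ has a minimum $\Lambda_{\min}$, and $\Lambda_{\min}<0$. Moreover: (a) Convergence. Suppose that the range of $\mathbf L_1$ is closed in $V'$, and let $0<\Delta t<-2/\Lambda_{\min}$.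 Then for every $\varepsilon>0$ there is $\delta>0$ such that, for every initial condition $(u_0,\mu_0)$ within $\delta$ of $(u,\mu)$ in $V\times\mathbb R$, the SOMI iterates converge in $V\times\mathbb R$ to $(U(c),\mu)$ for some $c$ with $|c-c^0|<\varepsilon$ and $\mathbf L_{00}U(c)-\mu U(c)=0$; that is, they converge to the solitary wave up to a slight shift of the free parameters. (b) Divergence. Let $\Delta t>-2/\Lambda_{\min}$. Then there is $\varepsilon>0$ such that arbitrarily close to $(u,\mu)$ there are initial conditions for which some SOMI iterate is at distance at least $\varepsilon$ from $(u,\mu)$. If moreover the interval $(\Lambda_{\min},-2/\Delta t]$ is not contained in the spectrum of $\mathcal L_I$ (for example, if $\Lambda_{\min}$ is an isolated point of the spectrum), then $\varepsilon>0$ can be chosen such that the initial conditions for which some SOMI iterate is at distance at least $\varepsilon$ from $(u,\mu)$ are dense in $V\times\mathbb R$. -/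

import Mathlib

open Filter Topology

open scoped RealInnerProductSpace

namespace SOMI

/-! Setting. `H` is the real Hilbert space carrying the inner product `⟨·,·⟩` (for vector functions of
`x ∈ ℝᴺ` it is `L²(ℝᴺ; ℝᴷ)`), and `V ⊆ H` is the energy space of the acceleration operator, i.e. the
form domain of `M` (for `M = c - Δ` it is `H¹(ℝᴺ; ℝᴷ)`).  As usual, operators such as `M`, `L₀₀`, `L₁`
act from `V` to its dual `V' ⊇ H`; the inclusion `V ⊆ H` is written `ι`, and `T u v` is `⟨T u, v⟩`. -/

variable {V : Type*} [NormedAddCommGroup V] [InnerProductSpace ℝ V]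
  {H : Type*} [NormedAddCommGroup H] [InnerProductSpace ℝ H]

/-- The inclusion `V ⊆ H ⊆ V'`: `u` is regarded as the functional `v ↦ ⟨u, v⟩`. -/
noncomputable def toDual (ι : V →L[ℝ] H) : V →L[ℝ] StrongDual ℝ V :=
  (innerSL ℝ (E := H)).bilinearComp ι ι

/-- The operator `L₀ u = L₀₀ u - μ u`. -/
noncomputable def L0 (ι : V →L[ℝ] H) (L00 : V → StrongDual ℝ V) (μ : ℝ) (u : V) :
    StrongDual ℝ V :=
  L00 u - μ • toDual ι u

/-- The linearization `L₁` of `L₀` (with `μ` fixed) around `u`. -/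
noncomputable def L1 (ι : V →L[ℝ] H) (L00 : V → StrongDual ℝ V) (μ : ℝ) (u : V) :
    V →L[ℝ] StrongDual ℝ V :=
  fderiv ℝ (L0 ι L00 μ) u

/-- The Hermitian adjoint `L₁†`, i.e. `⟨L₁† φ, ψ⟩ = ⟨L₁ ψ, φ⟩`. -/
noncomputable def L1adj (ι : V →L[ℝ] H) (L00 : V → StrongDual ℝ V) (μ : ℝ) (u : V) :
    V →L[ℝ] StrongDual ℝ V :=
  (L1 ι L00 μ u).flip

/-- One step `(uₙ, μₙ) ↦ (uₙ₊₁, μₙ₊₁)` of the iteration: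
`uₙ₊₁ = uₙ - [M⁻¹ L₁† M⁻¹ L₀ u] Δt` and `μₙ₊₁ = μₙ + ⟨u, M⁻¹ L₀ u⟩ Δt`,
the brackets being evaluated at `u = uₙ`, `μ = μₙ`. -/
noncomputable def step (M : V ≃L[ℝ] StrongDual ℝ V) (ι : V →L[ℝ] H)
    (L00 : V → StrongDual ℝ V) (Δt : ℝ) (z : V × ℝ) : V × ℝ :=
  (z.1 - Δt • M.symm (L1adj ι L00 z.2 z.1 (M.symm (L0 ι L00 z.2 z.1))),
   z.2 + Δt * ⟪ι z.1, ι (M.symm (L0 ι L00 z.2 z.1))⟫)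

/-- The linearized residual `(ũ, μ̃) ↦ L₁ ũ - μ̃ u`. -/
noncomputable def linResidual (ι : V →L[ℝ] H) (L00 : V → StrongDual ℝ V) (μ : ℝ) (u : V) :
    (V × ℝ) →L[ℝ] StrongDual ℝ V :=
  (L1 ι L00 μ u).comp (ContinuousLinearMap.fst ℝ V ℝ)
    - (ContinuousLinearMap.snd ℝ V ℝ).smulRight (toDual ι u)

/-- The augmented linearized operator
`𝓛_I (ũ, μ̃) = (-M⁻¹ L₁† M⁻¹ (L₁ ũ - μ̃ u), ⟨u, M⁻¹ (L₁ ũ - μ̃ u)⟩)`. -/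
noncomputable def augmented (M : V ≃L[ℝ] StrongDual ℝ V) (ι : V →L[ℝ] H)
    (L00 : V → StrongDual ℝ V) (μ : ℝ) (u : V) : (V × ℝ) →L[ℝ] (V × ℝ) :=
  let Minv : StrongDual ℝ V →L[ℝ] V := M.symm
  let R := linResidual ι L00 μ u
  (-(Minv.comp ((L1adj ι L00 μ u).comp (Minv.comp R)))).prod
    ((toDual ι u).comp (Minv.comp R))

theorem augmented_apply (M : V ≃L[ℝ] StrongDual ℝ V) (ι : V →L[ℝ] H)
    (L00 : V → StrongDual ℝ V) (μ : ℝ) (u v : V) (ν : ℝ) :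
    augmented M ι L00 μ u (v, ν) =
      (-M.symm (L1adj ι L00 μ u (M.symm (L1 ι L00 μ u v - ν • toDual ι u))),
        ⟪ι u, ι (M.symm (L1 ι L00 μ u v - ν • toDual ι u))⟫) := by
  simp [augmented, linResidual, toDual, inner_sub_right, inner_smul_right]

/-- `U(c₁, …, c_s)` is a continuously differentiable family of solutions of `L₀₀ u - μ u = 0` (for
`c` near `c₀`) through `u = U(c₀)`, and the kernel of `L₁` at `u` is spanned by the invariance modes
`∂U/∂c_j` at `c₀`. -/
structure KernelOnlyInvarianceModes (ι : V →L[ℝ] H) (L00 : V → StrongDual ℝ V) (μ : ℝ) (u : V)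
    {s : ℕ} (U : EuclideanSpace ℝ (Fin s) → V) (c₀ : EuclideanSpace ℝ (Fin s)) : Prop where
  base : U c₀ = u
  smooth : ContDiffAt ℝ 1 U c₀
  solution : ∀ᶠ c in 𝓝 c₀, L0 ι L00 μ (U c) = 0
  kernel : (L1 ι L00 μ u : V →ₗ[ℝ] StrongDual ℝ V).ker =
    Submodule.span ℝ (Set.range fun j : Fin s => fderiv ℝ U c₀ (EuclideanSpace.single j 1))

end SOMI

/-! Give `V` the inner product `⟨M v, v'⟩` and `V × ℝ` the inner product `⟨M v, v'⟩ + ν ν'`. In these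
coordinates the augmented operator is `-A† A`, where `A (ũ, μ̃) = M⁻¹ (L₁ ũ - μ̃ u)`. Its spectrum
therefore has the minimum `-‖A‖²`, and one step of the iteration has derivative `1 - Δt A† A` at the
solution.

When `Δt ‖A‖² < 2` and the range is closed, this derivative contracts strictly in the directions
orthogonal to `ker A`. Since `L₁ F = u` has no solution, `ker A` is `ker L₁ × 0`, which is spanned
by the tangent vectors of the family of fixed points `(U(c), μ)`. The distance to a local
retraction onto this family then decays geometrically, so the orbits converge to a point of it.

When `Δt ‖A‖² > 2`, the norms of the powers of the self-adjoint derivative grow geometrically, and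
orbits starting along nearly maximizing directions escape because the nonlinear remainder is
quadratic. If moreover some `b` with `2 / Δt < b < ‖A‖²` lies in the resolvent set of `A† A`, the
indefinite form `‖A x‖² - b ‖x‖²` is strictly expanded along differences of orbits, so no open set
of initial conditions can have all its orbits confined near the solution. -/

namespace SOMI

open scoped InnerProduct

section EscapeSet

/-- The set of initial conditions from which some iterate of `F` lies outside `W`. When `W` is a
neighbourhood of a fixed point `p`, the point `p` is unstable as soon as it belongs to the closure
of this set. -/
def escapeSet {X : Type*} (F : X → X) (W : Set X) : Set X := {z | ∃ n : ℕ, F^[n] z ∉ W}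

theorem iterate_conj_apply {X Y : Type*} (e : X ≃ Y) (F : X → X) (n : ℕ) (z : X) :
    (e.conj F)^[n] (e z) = e (F^[n] z) :=
  ((Function.Semiconj.iterate_right (f := e) (ga := F) (gb := e.conj F)
    (fun x => by simp [Equiv.conj_apply]) n) z).symm

theorem preimage_escapeSet_conj {X Y : Type*} (e : X ≃ Y) (F : X → X) (W : Set Y) :
    e ⁻¹' escapeSet (e.conj F) W = escapeSet F (e ⁻¹' W) := by
  ext z
  simp only [escapeSet, Set.mem_preimage, Set.mem_ofPred_eq, iterate_conj_apply]

theorem exists_escapeSet_subset_setOf_dist {X : Type*} [PseudoMetricSpace X] {p : X} {W : Set X}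
    (hW : W ∈ 𝓝 p) (F : X → X) :
    ∃ ε > 0, escapeSet F W ⊆ {z | ∃ n : ℕ, ε ≤ dist (F^[n] z) p} := by
  obtain ⟨ε, hε, hball⟩ := Metric.mem_nhds_iff.1 hW
  exact ⟨ε, hε, fun z ⟨n, hn⟩ => ⟨n, not_lt.1 fun h => hn (hball h)⟩⟩

end EscapeSet

section Instability

variable {E : Type*} [NormedAddCommGroup E] [NormedSpace ℝ E] {F : E → E} {p : E} {D : E →L[ℝ] E}

theorem norm_pow_apply_le {r : ℝ} (hDr : ‖D‖ ≤ r) (v : E) (n : ℕ) :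
    ‖(D ^ n) v‖ ≤ ‖v‖ * r ^ n := by
  induction n with
  | zero => simp
  | succ n ih =>
    rw [pow_succ' D, pow_succ r, ← mul_assoc, mul_comm _ r]
    exact D.le_of_opNorm_le_of_le hDr ih

theorem norm_map_sub_sub_apply_le (F : E → E) (p y w : E) :
    ‖F y - p - D w‖ ≤ ‖F y - p - D (y - p)‖ + ‖D‖ * ‖y - p - w‖ := by
  have hsplit : F y - p - D w = (F y - p - D (y - p)) + D (y - p - w) := by
    rw [map_sub D (y - p) w, sub_add_sub_cancel]
  rw [hsplit]
  exact norm_add_le_of_le le_rfl (D.le_opNorm _)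

theorem exists_norm_iterate_sub_pow_le {r : ℝ} (hr : 1 < r) (hDr : ‖D‖ ≤ r)
    (hF : (fun z => F z - p - D (z - p)) =O[𝓝 p] fun z => ‖z - p‖ ^ 2) :
    ∃ K > 0, ∃ a > 0, ∀ (v : E) (n : ℕ), ‖v‖ * r ^ n ≤ a →
      ‖F^[n] (p + v) - p - (D ^ n) v‖ ≤ K * (‖v‖ * r ^ n) ^ 2 := by
  obtain ⟨C, hC, hFC⟩ := hF.exists_pos
  obtain ⟨ρ, hρ, hFρ⟩ := Metric.eventually_nhds_iff.1 hFC.bound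
  have hrr : 0 < r ^ 2 - r := by nlinarith
  obtain ⟨K, hK, hKr⟩ : ∃ K > 0, r * K + 4 * C = K * r ^ 2 :=
    ⟨4 * C / (r ^ 2 - r), by positivity, by linarith [div_mul_cancel₀ (4 * C) hrr.ne']⟩
  obtain ⟨a, ha, haρ, haK⟩ : ∃ a > 0, 2 * a < ρ ∧ K * a ≤ 1 := by
    refine ⟨min (ρ / 4) (1 / K), by positivity, ?_, ?_⟩
    · linarith [min_le_left (ρ / 4) (1 / K)]
    · rw [← le_div_iff₀' hK]
      exact min_le_right _ _
  refine ⟨K, hK, a, ha, fun v n => ?_⟩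
  induction n with
  | zero =>
    intro _
    simpa using by positivity
  | succ n ih =>
    intro hn
    set q := ‖v‖ * r ^ n with hq
    have hqa : q ≤ a := le_trans (by rw [hq]; gcongr <;> grind) hn
    have hdev := ih hqa
    have hsize : ‖F^[n] (p + v) - p‖ ≤ 2 * q := by
      have hKq : K * q ^ 2 ≤ q := by
        rw [sq, ← mul_assoc]
        exact mul_le_of_le_one_left (by positivity) (le_trans (by gcongr) haK)
      linarith [norm_le_norm_sub_add (F^[n] (p + v) - p) ((D ^ n) v), norm_pow_apply_le hDr v n]
    have hrem : ‖F (F^[n] (p + v)) - p - D (F^[n] (p + v) - p)‖ ≤ C * (2 * q) ^ 2 := by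
      refine (hFρ (by rw [dist_eq_norm]; linarith)).trans ?_
      rw [Real.norm_of_nonneg (by positivity)]
      gcongr
    rw [Function.iterate_succ_apply', pow_succ', ContinuousLinearMap.mul_def,
      ContinuousLinearMap.comp_apply]
    calc ‖F (F^[n] (p + v)) - p - D ((D ^ n) v)‖
      _ ≤ C * (2 * q) ^ 2 + r * (K * q ^ 2) :=
          (norm_map_sub_sub_apply_le F p _ _).trans (by gcongr)
      _ = (r * K + 4 * C) * q ^ 2 := by ring
      _ = K * (‖v‖ * r ^ (n + 1)) ^ 2 := by rw [hKr, hq]; ring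

theorem exists_mem_closure_escapeSet (hD : 1 < ‖D‖) (hpow : ∀ n, ‖D‖ ^ n ≤ ‖D ^ n‖)
    (hF : (fun z => F z - p - D (z - p)) =O[𝓝 p] fun z => ‖z - p‖ ^ 2) :
    ∃ W ∈ 𝓝 p, p ∈ closure (escapeSet F W) := by
  obtain ⟨K, hK, a, ha, hdev⟩ := exists_norm_iterate_sub_pow_le hD le_rfl hF
  obtain ⟨b, hb, hba, hKb⟩ : ∃ b > 0, b ≤ a ∧ K * b ≤ 1 / 4 := by
    refine ⟨min a (1 / 4 / K), by positivity, min_le_left _ _, ?_⟩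
    rw [← le_div_iff₀' hK]
    exact min_le_right _ _
  have hr (n : ℕ) : 0 < ‖D‖ ^ n := by positivity
  have hx (n : ℕ) : ∃ x, ‖x‖ < 1 ∧ 3 / 4 * ‖D‖ ^ n < ‖(D ^ n) x‖ :=
    (D ^ n).exists_lt_apply_of_lt_opNorm (by linarith [hr n, hpow n])
  choose x hx1 hxn using hx
  set v : ℕ → E := fun n => (b / ‖D‖ ^ n) • x n with hv
  have hvb (n : ℕ) : ‖v n‖ ≤ b / ‖D‖ ^ n := by
    rw [hv, norm_smul, Real.norm_of_nonneg (by positivity)]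
    exact mul_le_of_le_one_right (by positivity) (hx1 n).le
  have hescape (n : ℕ) : p + v n ∈ escapeSet F (Metric.ball p (b / 2)) := by
    have hvn : ‖v n‖ * ‖D‖ ^ n ≤ b := (le_div_iff₀ (hr n)).1 (hvb n)
    have hlower : 3 / 4 * b ≤ ‖(D ^ n) (v n)‖ := by
      calc 3 / 4 * b = b / ‖D‖ ^ n * (3 / 4 * ‖D‖ ^ n) := by field_simp
        _ ≤ b / ‖D‖ ^ n * ‖(D ^ n) (x n)‖ := by gcongr; exact (hxn n).le
        _ = ‖(D ^ n) (v n)‖ := by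
          rw [hv, map_smul, norm_smul, Real.norm_of_nonneg (by positivity)]
    have hupper : ‖F^[n] (p + v n) - p - (D ^ n) (v n)‖ ≤ b / 4 :=
      calc _ ≤ K * (‖v n‖ * ‖D‖ ^ n) ^ 2 := hdev _ _ (hvn.trans hba)
        _ ≤ K * b ^ 2 := by gcongr
        _ ≤ b / 4 := by nlinarith
    refine ⟨n, fun hmem => ?_⟩
    rw [mem_ball_iff_norm] at hmem
    linarith [norm_le_norm_add_norm_sub (F^[n] (p + v n) - p) ((D ^ n) (v n))]
  have hv0 : Tendsto v atTop (𝓝 0) :=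
    squeeze_zero_norm hvb (tendsto_const_nhds.div_atTop (tendsto_pow_atTop_atTop_of_one_lt hD))
  have hlim : Tendsto (fun n => p + v n) atTop (𝓝 p) := by simpa using hv0.const_add p
  exact ⟨_, Metric.ball_mem_nhds p (half_pos hb),
    mem_closure_of_tendsto hlim (Eventually.of_forall hescape)⟩

theorem eventually_mul_le_apply_sub {B : E →L[ℝ] E →L[ℝ] ℝ} {c g : ℝ}
    (hF : HasStrictFDerivAt F D p) (hc : 0 < c)
    (hB : ∀ x, c * ‖x‖ ^ 2 + g * B x x ≤ B (D x) (D x)) :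
    ∀ᶠ y in 𝓝 (p, p), g * B (y.1 - y.2) (y.1 - y.2) ≤ B (F y.1 - F y.2) (F y.1 - F y.2) := by
  have hrem : (fun y : E × E => F y.1 - F y.2 - D (y.1 - y.2)) =o[𝓝 (p, p)]
      fun y => y.1 - y.2 := hF.isLittleO
  have hD : (fun y : E × E => D (y.1 - y.2)) =O[𝓝 (p, p)] fun y => y.1 - y.2 :=
    D.isBigO_comp _ _
  have hΔ : (fun y : E × E => F y.1 - F y.2) =O[𝓝 (p, p)] fun y => y.1 - y.2 := by
    simpa using hrem.isBigO.add hD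
  have hquad : (fun y : E × E => B (F y.1 - F y.2) (F y.1 - F y.2)
      - B (D (y.1 - y.2)) (D (y.1 - y.2))) =o[𝓝 (p, p)] fun y => ‖y.1 - y.2‖ * ‖y.1 - y.2‖ := by
    have hleft := (B.isBoundedBilinearMap.isBigO_comp
      (g := fun y : E × E => F y.1 - F y.2 - D (y.1 - y.2)) (h := fun y => F y.1 - F y.2)
      (l := 𝓝 (p, p))).trans_isLittleO (hrem.norm_norm.mul_isBigO hΔ.norm_norm)
    have hright := (B.isBoundedBilinearMap.isBigO_comp
      (g := fun y : E × E => D (y.1 - y.2)) (h := fun y => F y.1 - F y.2 - D (y.1 - y.2))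
      (l := 𝓝 (p, p))).trans_isLittleO (hD.norm_norm.mul_isLittleO hrem.norm_norm)
    refine (hleft.add hright).congr_left fun y => ?_
    simp only [map_sub, sub_apply]
    ring
  filter_upwards [hquad.def hc] with y hy
  rw [Real.norm_of_nonneg (by positivity : 0 ≤ ‖y.1 - y.2‖ * ‖y.1 - y.2‖), ← sq] at hy
  linarith [hB (y.1 - y.2), (abs_le.1 hy).1]

theorem dense_escapeSet {B : E →L[ℝ] E →L[ℝ] ℝ} {g : ℝ} {W : Set E} (hg : 1 < g)
    (hW : Bornology.IsBounded W)
    (hF : ∀ x ∈ W, ∀ y ∈ W, g * B (x - y) (x - y) ≤ B (F x - F y) (F x - F y))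
    {x₀ : E} (hx₀ : 0 < B x₀ x₀) : Dense (escapeSet F W) := by
  rw [← compl_compl (escapeSet F W), ← interior_eq_empty_iff_dense_compl,
    Set.eq_empty_iff_forall_notMem]
  intro z hz
  have hstay {y : E} (hy : y ∈ interior (escapeSet F W)ᶜ) (n : ℕ) : F^[n] y ∈ W := by
    by_contra h
    exact interior_subset hy ⟨n, h⟩
  obtain ⟨t, htz, ht⟩ : ∃ t : ℝ, z + t • x₀ ∈ interior (escapeSet F W)ᶜ ∧ 0 < t := by
    have hlim : Tendsto (fun t : ℝ => z + t • x₀) (𝓝[>] 0) (𝓝 z) := by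
      have hcont : Continuous fun t : ℝ => z + t • x₀ := by fun_prop
      simpa using (hcont.tendsto 0).mono_left nhdsWithin_le_nhds
    exact ((hlim.eventually (isOpen_interior.mem_nhds hz)).and self_mem_nhdsWithin).exists
  set δ : ℕ → E := fun n => F^[n] (z + t • x₀) - F^[n] z with hδ
  have hgrow (n : ℕ) : g ^ n * (t ^ 2 * B x₀ x₀) ≤ B (δ n) (δ n) := by
    induction n with
    | zero => simp [hδ]; linarith
    | succ n ih =>
      simp only [hδ, Function.iterate_succ_apply']
      refine le_trans ?_ (hF _ (hstay htz n) _ (hstay hz n))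
      rw [pow_succ', mul_assoc]
      gcongr
  have hbdd (n : ℕ) : B (δ n) (δ n) ≤ ‖B‖ * Metric.diam W * Metric.diam W := by
    have hδn : ‖δ n‖ ≤ Metric.diam W := by
      rw [hδ, ← dist_eq_norm]
      exact Metric.dist_le_diam_of_mem hW (hstay htz n) (hstay hz n)
    exact (le_abs_self _).trans ((B.le_opNorm₂ _ _).trans (by gcongr))
  have hlim : Tendsto (fun n : ℕ => g ^ n * (t ^ 2 * B x₀ x₀)) atTop atTop :=
    (tendsto_pow_atTop_atTop_of_one_lt hg).atTop_mul_const (by positivity)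
  obtain ⟨n, hn⟩ := (hlim.eventually_gt_atTop (‖B‖ * Metric.diam W * Metric.diam W)).exists
  exact ((hgrow n).trans (hbdd n)).not_gt hn

theorem exists_dense_escapeSet {B : E →L[ℝ] E →L[ℝ] ℝ} {c g : ℝ} (hF : HasStrictFDerivAt F D p)
    (hc : 0 < c) (hg : 1 < g) (hB : ∀ x, c * ‖x‖ ^ 2 + g * B x x ≤ B (D x) (D x))
    {x₀ : E} (hx₀ : 0 < B x₀ x₀) : ∃ W ∈ 𝓝 p, Dense (escapeSet F W) := by
  have hexpand := eventually_mul_le_apply_sub hF hc hB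
  rw [nhds_prod_eq, Metric.nhds_basis_ball.prod_self.eventually_iff] at hexpand
  obtain ⟨ε, hε, hball⟩ := hexpand
  exact ⟨_, Metric.ball_mem_nhds p hε, dense_escapeSet hg Metric.isBounded_ball
    (fun x hx y hy => hball (x := (x, y)) ⟨hx, hy⟩) hx₀⟩

end Instability

section Convergence

theorem exists_tendsto_of_dist_le_of_le_mul {X : Type*} [PseudoMetricSpace X] [CompleteSpace X]
    {x : ℕ → X} {w : ℕ → ℝ} {q κ : ℝ} (hq₀ : 0 ≤ q) (hq : q < 1) (hκ : 0 ≤ κ)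
    (hw₀ : ∀ n, 0 ≤ w n) (hw : ∀ n, w (n + 1) ≤ q * w n)
    (hx : ∀ n, dist (x n) (x (n + 1)) ≤ κ * w n) :
    Tendsto w atTop (𝓝 0) ∧ ∃ y, Tendsto x atTop (𝓝 y) := by
  have hwn (n : ℕ) : w n ≤ w 0 * q ^ n := by
    rw [mul_comm]
    exact le_geom hq₀ n fun k _ => hw k
  refine ⟨squeeze_zero hw₀ hwn ?_, cauchySeq_tendsto_of_complete ?_⟩
  · simpa using (tendsto_pow_atTop_nhds_zero_of_lt_one hq₀ hq).const_mul (w 0)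
  · refine cauchySeq_of_le_geometric q (κ * w 0) hq fun n => (hx n).trans ?_
    rw [mul_assoc]
    gcongr
    exact hwn n

theorem eventually_exists_tendsto_iterate_of_displacement_le {X : Type*} [PseudoMetricSpace X]
    [CompleteSpace X] {F : X → X} {w : X → ℝ} {p : X} {q κ : ℝ} {S : Set X} (hq₀ : 0 ≤ q)
    (hq : q < 1) (hκ : 0 ≤ κ) (hw₀ : ∀ z, 0 ≤ w z) (hwp : w p = 0)
    (hwc : ∀ᶠ z in 𝓝 p, ContinuousAt w z) (hwF : ∀ᶠ z in 𝓝 p, w (F z) ≤ q * w z)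
    (hF : ∀ᶠ z in 𝓝 p, dist z (F z) ≤ κ * w z) (hS : S ∈ 𝓝 p) :
    ∀ᶠ z in 𝓝 p, ∃ z' ∈ S, w z' = 0 ∧ Tendsto (fun n => F^[n] z) atTop (𝓝 z') := by
  obtain ⟨r, hr, hball⟩ := Metric.nhds_basis_closedBall.mem_iff.1
    (hwc.and (hwF.and (hF.and (eventually_mem_set.2 hS))))
  have hq' : 0 < 1 - q := sub_pos.2 hq
  -- `dist z p` can grow along the orbit, but this Lyapunov function cannot.
  set Φ : X → ℝ := fun z => dist z p + κ / (1 - q) * w z with hΦ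
  have hdist (z : X) : dist z p ≤ Φ z := le_add_of_nonneg_right (by have := hw₀ z; positivity)
  have hinv {z : X} (hz : Φ z < r) : Φ (F z) < r := by
    obtain ⟨-, hwz, hFz, -⟩ := hball (Metric.mem_closedBall.2 ((hdist z).trans hz.le))
    calc Φ (F z) ≤ dist z p + κ * w z + κ / (1 - q) * (q * w z) := by
          have : dist (F z) p ≤ dist z p + κ * w z := by
            linarith [dist_triangle_left (F z) p z]
          simp only [hΦ]
          gcongr
      _ = Φ z := by simp only [hΦ]; field_simp; ring
      _ < r := hz
  have hΦp : ∀ᶠ z in 𝓝 p, Φ z < r := by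
    have hcont : ContinuousAt Φ p :=
      (continuousAt_id.dist continuousAt_const).add (continuousAt_const.mul hwc.self_of_nhds)
    exact hcont.eventually (gt_mem_nhds (by simpa [hΦ, hwp] using hr))
  filter_upwards [hΦp] with z hz
  have hΦn (n : ℕ) : Φ (F^[n] z) < r := by
    induction n with
    | zero => exact hz
    | succ n ih => rw [Function.iterate_succ_apply']; exact hinv ih
  have hmem (n : ℕ) : F^[n] z ∈ Metric.closedBall p r := (hdist _).trans (hΦn n).le
  obtain ⟨hwlim, z', hz'⟩ := exists_tendsto_of_dist_le_of_le_mul (x := fun n => F^[n] z)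
    hq₀ hq hκ (fun n => hw₀ (F^[n] z))
    (fun n => by simpa only [Function.iterate_succ_apply'] using (hball (hmem n)).2.1)
    (fun n => by simpa only [Function.iterate_succ_apply'] using (hball (hmem n)).2.2.1)
  obtain ⟨hwz', -, -, hz'S⟩ :=
    hball (Metric.isClosed_closedBall.mem_of_tendsto hz' (Eventually.of_forall hmem))
  exact ⟨z', hz'S, tendsto_nhds_unique (hwz'.tendsto.comp hz') hwlim, hz'⟩

section Retraction

variable {E : Type*} [NormedAddCommGroup E] [NormedSpace ℝ E]
  {G : Type*} [NormedAddCommGroup G] [NormedSpace ℝ G]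
  {X : Type*} [NormedAddCommGroup X] [NormedSpace ℝ X]
  {F : E → E} {D : E →L[ℝ] E} {p : E}

theorem eventually_norm_le_mul_norm_sub {f : E → G} {f' : E →L[ℝ] G} {ρ : E → E} {q : ℝ}
    (hf : HasStrictFDerivAt f f' p) (hq : ‖f'‖ < q) (hρ : ContinuousAt ρ p) (hρp : ρ p = p)
    (hfρ : ∀ᶠ z in 𝓝 p, f (ρ z) = 0) : ∀ᶠ z in 𝓝 p, ‖f z‖ ≤ q * ‖z - ρ z‖ := by
  lift q to NNReal using (norm_nonneg f').trans hq.le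
  obtain ⟨s, hs, hlip⟩ := hf.exists_lipschitzOnWith_of_nnnorm_lt q hq
  filter_upwards [hs, hρ.preimage_mem_nhds (hρp.symm ▸ hs), hfρ] with z hz hρz hfz
  simpa [hfz] using hlip.norm_sub_le hz hρz

theorem eventually_exists_tendsto_iterate_of_retraction [CompleteSpace E] {ρ : E → E}
    {Q : E →L[ℝ] E} {S : Set E} (hρ : HasStrictFDerivAt ρ Q p) (hF : HasStrictFDerivAt F D p)
    (hρp : ρ p = p) (hρρ : ∀ᶠ z in 𝓝 p, ρ (ρ z) = ρ z) (hFρ : ∀ᶠ z in 𝓝 p, F (ρ z) = ρ z)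
    (hQD : ‖(1 - Q) ∘L D‖ < 1) (hS : S ∈ 𝓝 p) :
    ∀ᶠ z in 𝓝 p, ∃ z' ∈ S, ρ z' = z' ∧ Tendsto (fun n => F^[n] z) atTop (𝓝 z') := by
  have hFp : F p = p := by simpa [hρp] using hFρ.self_of_nhds
  obtain ⟨q, hDq, hq⟩ := exists_between hQD
  have hcontract : ∀ᶠ z in 𝓝 p, ‖F z - ρ (F z)‖ ≤ q * ‖z - ρ z‖ := by
    have hρF : HasStrictFDerivAt (fun z => ρ (F z)) (Q ∘L D) p :=
      HasStrictFDerivAt.comp p (by rwa [hFp]) hF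
    refine eventually_norm_le_mul_norm_sub (hF.fun_sub hρF) ?_ hρ.continuousAt hρp ?_
    · simpa [ContinuousLinearMap.sub_comp, ContinuousLinearMap.one_def] using hDq
    · filter_upwards [hρρ, hFρ] with z h₁ h₂
      rw [h₂, h₁, sub_self]
  have hdisplace : ∀ᶠ z in 𝓝 p, dist z (F z) ≤ (‖D - .id ℝ E‖ + 1) * ‖z - ρ z‖ := by
    simp only [dist_eq_norm']
    refine eventually_norm_le_mul_norm_sub (hF.fun_sub (hasStrictFDerivAt_id p)) (lt_add_one _)
      hρ.continuousAt hρp ?_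
    filter_upwards [hFρ] with z hz
    rw [hz, sub_self]
  have hcont : ∀ᶠ z in 𝓝 p, ContinuousAt (fun z => ‖z - ρ z‖) z := by
    obtain ⟨K, s, hs, hlip⟩ := hρ.exists_lipschitzOnWith
    filter_upwards [eventually_mem_nhds_iff.2 hs] with z hz
    exact (continuousAt_id.sub (hlip.continuousOn.continuousAt hz)).norm
  filter_upwards [eventually_exists_tendsto_iterate_of_displacement_le
    ((norm_nonneg _).trans hDq.le) hq (by positivity) (fun z => norm_nonneg (z - ρ z))
    (by simp [hρp]) hcont hcontract hdisplace hS] with z ⟨z', hz'S, hz', hlim⟩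
  exact ⟨z', hz'S, (sub_eq_zero.1 (norm_eq_zero.1 hz')).symm, hlim⟩

theorem exists_local_leftInverse [CompleteSpace X] {Ψ : X → E} {Ψ' : X →L[ℝ] E} {P : E →L[ℝ] X}
    {x : X} (hΨ : HasStrictFDerivAt Ψ Ψ' x) (hP : P ∘L Ψ' = .id ℝ X) :
    ∃ τ : E → X, HasStrictFDerivAt τ P (Ψ x) ∧ ∀ᶠ y in 𝓝 x, τ (Ψ y) = y := by
  have hPΨ : HasStrictFDerivAt (P ∘ Ψ)
      ((ContinuousLinearEquiv.refl ℝ X : X ≃L[ℝ] X) : X →L[ℝ] X) x := by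
    rw [ContinuousLinearEquiv.coe_refl, ← hP]
    exact P.hasStrictFDerivAt.comp x hΨ
  exact ⟨hPΨ.localInverse _ _ _ ∘ P, hPΨ.to_localInverse.comp (Ψ x) P.hasStrictFDerivAt,
    hPΨ.eventually_left_inverse⟩

theorem eventually_exists_tendsto_iterate_of_family [CompleteSpace E] [CompleteSpace X] {Ψ : X → E}
    {Ψ' : X →L[ℝ] E} {P : E →L[ℝ] X} {x : X} {N : Set X} (hΨ : HasStrictFDerivAt Ψ Ψ' x)
    (hP : P ∘L Ψ' = .id ℝ X) (hF : HasStrictFDerivAt F D (Ψ x))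
    (hFΨ : ∀ᶠ y in 𝓝 x, F (Ψ y) = Ψ y) (hPD : ‖(1 - Ψ' ∘L P) ∘L D‖ < 1) (hN : N ∈ 𝓝 x) :
    ∀ᶠ z in 𝓝 (Ψ x), ∃ y ∈ N, Tendsto (fun n => F^[n] z) atTop (𝓝 (Ψ y)) := by
  obtain ⟨τ, hτ, hτΨ⟩ := exists_local_leftInverse hΨ hP
  have hτx : τ (Ψ x) = x := hτΨ.self_of_nhds
  have hτlim : Tendsto τ (𝓝 (Ψ x)) (𝓝 x) := by simpa [hτx] using hτ.continuousAt.tendsto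
  have hρ : HasStrictFDerivAt (fun z => Ψ (τ z)) (Ψ' ∘L P) (Ψ x) :=
    HasStrictFDerivAt.comp (Ψ x) (by rwa [hτx]) hτ
  have hρρ : ∀ᶠ z in 𝓝 (Ψ x), Ψ (τ (Ψ (τ z))) = Ψ (τ z) := by
    filter_upwards [hτlim.eventually hτΨ] with z hz
    rw [hz]
  filter_upwards [eventually_exists_tendsto_iterate_of_retraction hρ hF (by rw [hτx]) hρρ
    (hτlim.eventually hFΨ) hPD (hτlim hN)] with z ⟨z', hz'N, hz', hlim⟩
  exact ⟨τ z', hz'N, hz'.symm ▸ hlim⟩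

end Retraction

end Convergence

section OperatorNorm

variable {E Z : Type*} [SeminormedAddCommGroup E] [NormedSpace ℝ E] [SeminormedAddCommGroup Z]
  [NormedSpace ℝ Z] {A : E →L[ℝ] Z} {c : ℝ}

theorem opNorm_le_sqrt (h : ∀ x, ‖A x‖ ^ 2 ≤ c * ‖x‖ ^ 2) : ‖A‖ ≤ √c := by
  refine A.opNorm_le_bound (Real.sqrt_nonneg c) fun x => ?_
  have := Real.le_sqrt_of_sq_le (h x)
  rwa [Real.sqrt_mul' _ (sq_nonneg _), Real.sqrt_sq (norm_nonneg x)] at this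

theorem exists_mul_norm_sq_lt_norm_apply_sq (hA : 0 < ‖A‖) (hc : c < ‖A‖ ^ 2) : ∃ x, c * ‖x‖ ^ 2 < ‖A x‖ ^ 2 := by
  by_contra! h
  exact hc.not_ge ((Real.le_sqrt' (hA)).1 (opNorm_le_sqrt h))

end OperatorNorm

section Hilbert

variable {E : Type*} [NormedAddCommGroup E] [InnerProductSpace ℝ E]
  {Z : Type*} [NormedAddCommGroup Z] [InnerProductSpace ℝ Z] {A : E →L[ℝ] Z} {t : ℝ}

theorem norm_pow_le_norm_pow_of_isSelfAdjoint [CompleteSpace E] [Nontrivial E] {D : E →L[ℝ] E}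
    (hD : IsSelfAdjoint D) (n : ℕ) : ‖D‖ ^ n ≤ ‖D ^ n‖ := by
  rcases eq_or_ne n 0 with rfl | hn
  · simp
  have h := spectrum.spectralRadius_pow_le (𝕜 := ℝ) D n hn
  have hradius {T : E →L[ℝ] E} (hT : IsSelfAdjoint T) : spectralRadius ℝ T = ‖T‖₊ :=
    ContinuousLinearMap.spectralRadius_eq_nnnorm T hT
  rw [hradius hD, hradius (hD.pow n)] at h
  exact_mod_cast h

section Spectrum

variable [CompleteSpace E] [CompleteSpace Z]

theorem inner_adjoint_comp_self (A : E →L[ℝ] Z) (x : E) : ⟪(A† ∘L A) x, x⟫ = ‖A x‖ ^ 2 := by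
  rw [ContinuousLinearMap.comp_apply, ContinuousLinearMap.adjoint_inner_left,
    real_inner_self_eq_norm_sq]

theorem norm_sq_mem_spectrum_adjoint_comp_self (hA : A ≠ 0) :
    ‖A‖ ^ 2 ∈ spectrum ℝ (A† ∘L A) := by
  obtain ⟨x, hx⟩ := DFunLike.ne_iff.1 hA
  have : Nontrivial E := ⟨x, 0, fun h => hx (by simp [h])⟩
  have hnorm : ‖A† ∘L A‖ = ‖A‖ ^ 2 := by rw [A.norm_adjoint_comp_self, sq]
  by_contra hres
  rw [← hnorm] at hres
  obtain ⟨ε, hε, hquot⟩ := ContinuousLinearMap.rayleighQuotient_le_of_norm_mem_resolventSet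
    (T := A† ∘L A) (not_not.1 hres)
  obtain ⟨y, hy⟩ := exists_mul_norm_sq_lt_norm_apply_sq (norm_pos_iff.2 hA) (sub_lt_self (‖A‖ ^ 2) hε)
  have hy₀ : y ≠ 0 := by
    rintro rfl
    simp at hy
  have hle := hquot y
  rw [ContinuousLinearMap.rayleighQuotient, ContinuousLinearMap.reApplyInnerSelf_apply,
    RCLike.re_to_real, inner_adjoint_comp_self, hnorm, div_le_iff₀ (by positivity)] at hle
  exact hy.not_ge hle

theorem isLeast_spectrum_neg_adjoint_comp_self (hA : A ≠ 0) :
    IsLeast (spectrum ℝ (-(A† ∘L A))) (-‖A‖ ^ 2) := by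
  rw [← spectrum.neg_eq]
  refine ⟨by simpa using norm_sq_mem_spectrum_adjoint_comp_self hA, fun ν hν => ?_⟩
  have hle := spectrum.norm_le_norm_mul_of_mem (Set.mem_neg.1 hν)
  rw [A.norm_adjoint_comp_self, ← sq] at hle
  have hone : ‖(1 : E →L[ℝ] E)‖ ≤ 1 := ContinuousLinearMap.norm_id_le
  have : -ν ≤ ‖A‖ ^ 2 := (Real.le_norm_self _).trans
    (hle.trans (mul_le_of_le_one_right (sq_nonneg _) hone))
  linarith

end Spectrum

section Instability

variable [CompleteSpace E] [CompleteSpace Z] {F : E → E} {p : E}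

theorem exists_mem_closure_escapeSet_of_adjoint_comp_self (ht : 0 ≤ t) (hA : 2 < t * ‖A‖ ^ 2)
    (hF : (fun z => F z - p - (1 - t • (A† ∘L A)) (z - p)) =O[𝓝 p] fun z => ‖z - p‖ ^ 2) :
    ∃ W ∈ 𝓝 p, p ∈ closure (escapeSet F W) := by
  have hD : 1 < ‖1 - t • (A† ∘L A)‖ := by
    have hone : ‖(1 : E →L[ℝ] E)‖ ≤ 1 := ContinuousLinearMap.norm_id_le
    calc (1 : ℝ) < t * ‖A‖ ^ 2 - ‖(1 : E →L[ℝ] E)‖ := by linarith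
      _ = ‖t • (A† ∘L A)‖ - ‖(1 : E →L[ℝ] E)‖ := by
        rw [norm_smul, Real.norm_of_nonneg ht, A.norm_adjoint_comp_self, sq]
      _ ≤ ‖1 - t • (A† ∘L A)‖ := by
        rw [norm_sub_rev]
        exact norm_sub_norm_le _ _
  have hsa : IsSelfAdjoint (1 - t • (A† ∘L A)) :=
    (IsSelfAdjoint.one _).sub
      ((IsSelfAdjoint.all t).smul A.isPositive_adjoint_comp_self.isSelfAdjoint)
  have : Nontrivial E := by
    by_contra h
    have := not_nontrivial_iff_subsingleton.1 h
    rw [Subsingleton.elim A 0, norm_zero] at hA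
    norm_num at hA
  exact exists_mem_closure_escapeSet hD (norm_pow_le_norm_pow_of_isSelfAdjoint hsa) hF

theorem exists_mem_resolventSet_between {T : E →L[ℝ] E} {a a' : ℝ} (haa' : a < a')
    (ha : a ∉ spectrum ℝ T) : ∃ b ∈ resolventSet ℝ T, a < b ∧ b < a' := by
  have hres : ∀ᶠ b in 𝓝[>] a, b ∈ resolventSet ℝ T :=
    nhdsWithin_le_nhds ((spectrum.isOpen_resolventSet T).mem_nhds (not_not.1 ha))
  exact (hres.and (Ioo_mem_nhdsGT haa')).exists

theorem exists_expansion_adjoint_comp_self_sub {b : ℝ} (ht : 0 < t) (htb : 2 < t * b)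
    (hb : b ∈ resolventSet ℝ (A† ∘L A)) :
    ∃ c > 0, ∀ x, c * ‖x‖ ^ 2 + (t * b - 1) ^ 2 * (‖A x‖ ^ 2 - b * ‖x‖ ^ 2) ≤
      ‖A ((1 - t • (A† ∘L A)) x)‖ ^ 2 - b * ‖(1 - t • (A† ∘L A)) x‖ ^ 2 := by
  obtain ⟨d, hd, hSd⟩ := antilipschitzWith_iff_exists_mul_le_norm.mp
    ((algebraMap ℝ (E →L[ℝ] E) b - A† ∘L A).antilipschitz_of_isEmbedding
      (ContinuousLinearMap.isHomeomorph_of_isUnit hb).isEmbedding)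
  have hc : 0 < t * (t * b - 2) := mul_pos ht (by linarith)
  refine ⟨t * (t * b - 2) * d ^ 2, mul_pos hc (pow_pos hd 2), fun x => ?_⟩
  obtain ⟨w, hw⟩ : ∃ w, w = b • x - (A† ∘L A) x := ⟨_, rfl⟩
  have hdw : d * ‖x‖ ≤ ‖w‖ := by
    rw [hw]
    exact hSd x
  have hD : (1 - t • (A† ∘L A)) x = t • w - (t * b - 1) • x := by
    rw [hw, sub_apply, smul_apply, one_apply_eq_self]
    module
  have hAA : ⟪A w, A x⟫ = b * ⟪w, x⟫ - ‖w‖ ^ 2 := by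
    rw [← ContinuousLinearMap.adjoint_inner_right, ← ContinuousLinearMap.comp_apply,
      show (A† ∘L A) x = b • x - w by rw [hw]; abel, inner_sub_right, real_inner_smul_right,
      real_inner_self_eq_norm_sq]
  have hexpand : ‖A ((1 - t • (A† ∘L A)) x)‖ ^ 2 - b * ‖(1 - t • (A† ∘L A)) x‖ ^ 2 =
      t * (t * b - 2) * ‖w‖ ^ 2 + t ^ 2 * ‖A w‖ ^ 2
        + (t * b - 1) ^ 2 * (‖A x‖ ^ 2 - b * ‖x‖ ^ 2) := by
    rw [hD, map_sub, map_smul, map_smul, norm_sub_sq_real, norm_sub_sq_real]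
    simp only [real_inner_smul_left, real_inner_smul_right, norm_smul, mul_pow, hAA,
      Real.norm_eq_abs, sq_abs]
    ring
  have hsq : t * (t * b - 2) * (d ^ 2 * ‖x‖ ^ 2) ≤ t * (t * b - 2) * ‖w‖ ^ 2 := by
    rw [← mul_pow]
    gcongr
  have hAw : 0 ≤ t ^ 2 * ‖A w‖ ^ 2 := by positivity
  linarith

theorem exists_dense_escapeSet_of_adjoint_comp_self {a : ℝ} (ht : 0 < t) (hta : 2 ≤ t * a)
    (ha : a < ‖A‖ ^ 2) (hspec : a ∉ spectrum ℝ (A† ∘L A))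
    (hF : HasStrictFDerivAt F (1 - t • (A† ∘L A)) p) : ∃ W ∈ 𝓝 p, Dense (escapeSet F W) := by
  obtain ⟨b, hb, hab, hbA⟩ := exists_mem_resolventSet_between ha hspec
  have htb : 2 < t * b := hta.trans_lt (by gcongr)
  obtain ⟨c, hc, hexp⟩ := exists_expansion_adjoint_comp_self_sub ht htb hb
  have hA : A ≠ 0 := by
    rintro rfl
    have : 0 < b := pos_of_mul_pos_right (two_pos.trans htb) ht.le
    rw [norm_zero, zero_pow two_ne_zero] at hbA
    exact this.not_gt hbA
  obtain ⟨x₀, hx₀⟩ := exists_mul_norm_sq_lt_norm_apply_sq (norm_pos_iff.2 hA) hbA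
  let B : E →L[ℝ] E →L[ℝ] ℝ := innerSL ℝ ∘L (A† ∘L A - b • .id ℝ E)
  have hB (x : E) : B x x = ‖A x‖ ^ 2 - b * ‖x‖ ^ 2 := by
    rw [← inner_adjoint_comp_self, ← real_inner_self_eq_norm_sq, ← real_inner_smul_left,
      ← inner_sub_left]
    rfl
  refine exists_dense_escapeSet (B := B) (g := (t * b - 1) ^ 2) hF hc ?_ (fun x => ?_)
    (x₀ := x₀) ?_
  · exact one_lt_pow₀ (by linarith) two_ne_zero
  · rw [hB, hB]
    exact hexp x
  · rw [hB]
    exact sub_pos.2 hx₀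

end Instability

section Convergence

theorem exists_mul_norm_le_norm_apply_of_isClosed_range [CompleteSpace E] {Y : Type*}
    [NormedAddCommGroup Y] [NormedSpace ℝ Y] [CompleteSpace Y] {R : E →L[ℝ] Y}
    (hR : IsClosed (Set.range R)) : ∃ d > 0, ∀ x ∈ R.kerᗮ, d * ‖x‖ ≤ ‖R x‖ := by
  have hinj : Function.Injective (R ∘L R.kerᗮ.subtypeL) := by
    rw [injective_iff_map_eq_zero]
    intro x hx
    exact Subtype.ext
      (inner_self_eq_zero.1 (Submodule.inner_right_of_mem_orthogonal (K := R.ker) hx x.2))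
  have hrange : Set.range (R ∘L R.kerᗮ.subtypeL) = Set.range R := by
    refine Set.Subset.antisymm (Set.range_comp_subset_range _ R) ?_
    rintro _ ⟨x, rfl⟩
    have hker : R (R.ker.starProjection x) = 0 := R.ker.starProjection_apply_mem x
    refine ⟨⟨_, R.ker.sub_starProjection_mem_orthogonal x⟩, ?_⟩
    rw [ContinuousLinearMap.comp_apply, Submodule.subtypeL_apply, map_sub, hker, sub_zero]
  obtain ⟨K, hK⟩ := (R ∘L R.kerᗮ.subtypeL).antilipschitz_of_injective_of_isClosed_range hinj
    (hrange ▸ hR)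
  obtain ⟨d, hd, h⟩ := antilipschitzWith_iff_exists_mul_le_norm.mp ⟨K, hK⟩
  exact ⟨d, hd, fun x hx => h ⟨x, hx⟩⟩

theorem exists_comp_eq_subtypeL_of_le_range {C : Type*} [NormedAddCommGroup C] [NormedSpace ℝ C]
    [FiniteDimensional ℝ C] {L : C →L[ℝ] E} {K : Submodule ℝ E} (hK : K ≤ L.range) :
    ∃ J : K →L[ℝ] C, L ∘L J = K.subtypeL := by
  have : FiniteDimensional ℝ K := Submodule.finiteDimensional_of_le hK
  obtain ⟨J, hJ⟩ := Module.projective_lifting_property (L : C →ₗ[ℝ] E).rangeRestrict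
    (Submodule.inclusion hK) (L : C →ₗ[ℝ] E).surjective_rangeRestrict
  refine ⟨J.toContinuousLinearMap, ?_⟩
  ext k
  exact congrArg Subtype.val (LinearMap.congr_fun hJ k)

variable [CompleteSpace E] [CompleteSpace Z]

theorem norm_sub_smul_adjoint_apply_sq_le (ht : 0 ≤ t) (x : E) :
    ‖x - t • (A† ∘L A) x‖ ^ 2 ≤ ‖x‖ ^ 2 - t * (2 - t * ‖A‖ ^ 2) * ‖A x‖ ^ 2 := by
  have hadj : ‖(A†) (A x)‖ ^ 2 ≤ ‖A‖ ^ 2 * ‖A x‖ ^ 2 := by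
    rw [← mul_pow, ← LinearIsometryEquiv.norm_map ContinuousLinearMap.adjoint A]
    gcongr
    exact (A†).le_opNorm _
  rw [ContinuousLinearMap.comp_apply, norm_sub_sq_real, real_inner_smul_right,
    ContinuousLinearMap.adjoint_inner_right,
    real_inner_self_eq_norm_sq, norm_smul, Real.norm_of_nonneg ht]
  nlinarith [mul_le_mul_of_nonneg_left hadj (sq_nonneg t)]

theorem starProjection_ker_orthogonal_comp_one_sub_apply (x : E) :
    A.kerᗮ.starProjection ((1 - t • (A† ∘L A)) x) =
      A.kerᗮ.starProjection x - t • (A† ∘L A) (A.kerᗮ.starProjection x) := by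
  have hrange : (A† ∘L A) x ∈ A.kerᗮ := fun y (hy : A y = 0) => by
    rw [ContinuousLinearMap.comp_apply, ContinuousLinearMap.adjoint_inner_right, hy,
      inner_zero_left]
  have hproj : A (A.kerᗮ.starProjection x) = A x := by
    have hker : A (A.ker.starProjection x) = 0 := A.ker.starProjection_apply_mem x
    rw [A.ker.starProjection_orthogonal_val, map_sub, hker, sub_zero]
  rw [sub_apply, smul_apply, one_apply_eq_self, map_sub, map_smul,
    Submodule.starProjection_eq_self_iff.2 hrange]
  simp only [ContinuousLinearMap.comp_apply, hproj]

theorem norm_starProjection_ker_orthogonal_comp_one_sub_lt_one (hA : IsClosed (Set.range A))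
    (ht : 0 < t) (htA : t * ‖A‖ ^ 2 < 2) :
    ‖A.kerᗮ.starProjection ∘L (1 - t • (A† ∘L A))‖ < 1 := by
  obtain ⟨d, hd, hdA⟩ := exists_mul_norm_le_norm_apply_of_isClosed_range hA
  have hgain : 0 < t * (2 - t * ‖A‖ ^ 2) := mul_pos ht (by linarith)
  refine (opNorm_le_sqrt (c := max 0 (1 - t * (2 - t * ‖A‖ ^ 2) * d ^ 2)) fun x => ?_).trans_lt ?_
  · set y := A.kerᗮ.starProjection x
    have hdy : d ^ 2 * ‖y‖ ^ 2 ≤ ‖A y‖ ^ 2 := by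
      rw [← mul_pow]
      gcongr
      exact hdA y (A.kerᗮ.starProjection_apply_mem x)
    calc ‖A.kerᗮ.starProjection ((1 - t • (A† ∘L A)) x)‖ ^ 2
        = ‖y - t • (A† ∘L A) y‖ ^ 2 := by rw [starProjection_ker_orthogonal_comp_one_sub_apply]
      _ ≤ ‖y‖ ^ 2 - t * (2 - t * ‖A‖ ^ 2) * ‖A y‖ ^ 2 :=
        norm_sub_smul_adjoint_apply_sq_le ht.le y
      _ ≤ (1 - t * (2 - t * ‖A‖ ^ 2) * d ^ 2) * ‖y‖ ^ 2 := by
        linarith [mul_le_mul_of_nonneg_left hdy hgain.le]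
      _ ≤ max 0 (1 - t * (2 - t * ‖A‖ ^ 2) * d ^ 2) * ‖x‖ ^ 2 := by
        gcongr
        · exact le_max_right _ _
        · exact A.kerᗮ.norm_starProjection_apply_le x
  · rw [Real.sqrt_lt' one_pos, one_pow, max_lt_iff]
    exact ⟨one_pos, by linarith [mul_pos hgain (pow_pos hd 2)]⟩

theorem eventually_exists_tendsto_iterate_of_adjoint_comp_self {C : Type*} [NormedAddCommGroup C]
    [NormedSpace ℝ C] [FiniteDimensional ℝ C] {F : E → E} {Φ : C → E} {Φ' : C →L[ℝ] E} {c₀ : C}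
    {N : Set C} (hA : IsClosed (Set.range A)) (ht : 0 < t) (htA : t * ‖A‖ ^ 2 < 2)
    (hF : HasStrictFDerivAt F (1 - t • (A† ∘L A)) (Φ c₀)) (hΦ : HasStrictFDerivAt Φ Φ' c₀)
    (hFΦ : ∀ᶠ c in 𝓝 c₀, F (Φ c) = Φ c) (hker : A.ker ≤ Φ'.range) (hN : N ∈ 𝓝 c₀) :
    ∀ᶠ z in 𝓝 (Φ c₀), ∃ c ∈ N, Tendsto (fun n => F^[n] z) atTop (𝓝 (Φ c)) := by
  obtain ⟨J, hJ⟩ := exists_comp_eq_subtypeL_of_le_range hker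
  have hJ₀ : HasStrictFDerivAt (fun k => c₀ + J k) J 0 := J.hasStrictFDerivAt.const_add c₀
  have hJlim : Tendsto (fun k => c₀ + J k) (𝓝 0) (𝓝 c₀) := by
    simpa using hJ₀.continuousAt.tendsto
  have hΨ : HasStrictFDerivAt (fun k => Φ (c₀ + J k)) A.ker.subtypeL 0 := by
    rw [← hJ]
    exact HasStrictFDerivAt.comp 0 (by simpa using hΦ) hJ₀
  have hleft : A.ker.orthogonalProjectionOnto ∘L A.ker.subtypeL = .id ℝ A.ker :=
    ContinuousLinearMap.ext fun k => A.ker.orthogonalProjectionOnto_mem_subspace_eq_self k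
  have hcontract :
      ‖(1 - A.ker.subtypeL ∘L A.ker.orthogonalProjectionOnto) ∘L (1 - t • (A† ∘L A))‖ < 1 := by
    have := norm_starProjection_ker_orthogonal_comp_one_sub_lt_one hA ht htA
    rwa [A.ker.starProjection_orthogonal'] at this
  have hlim := eventually_exists_tendsto_iterate_of_family hΨ hleft (by simpa using hF)
    (hJlim.eventually hFΦ) hcontract (hJlim hN)
  simp only [map_zero, add_zero] at hlim
  filter_upwards [hlim] with z ⟨k, hk, hzk⟩
  exact ⟨c₀ + J k, hk, hzk⟩

end Convergence

end Hilbert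

section Conjugation

variable {X Y : Type*} [NormedAddCommGroup X] [NormedSpace ℝ X] [NormedAddCommGroup Y]
  [NormedSpace ℝ Y] {F : X → X} {D : X →L[ℝ] X} {p : X}

theorem hasStrictFDerivAt_conj (e : X ≃L[ℝ] Y) (hF : HasStrictFDerivAt F D p) :
    HasStrictFDerivAt (e.toEquiv.conj F) (e.conjContinuousAlgEquiv D) (e p) := by
  have hF' : HasStrictFDerivAt F D (e.symm (e p)) := by rwa [e.symm_apply_apply]
  exact (e : X →L[ℝ] Y).hasStrictFDerivAt.comp (e p)
    (hF'.comp (e p) (e.symm : Y →L[ℝ] X).hasStrictFDerivAt)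

theorem isBigO_conj (e : X ≃L[ℝ] Y)
    (hF : (fun z => F z - p - D (z - p)) =O[𝓝 p] fun z => ‖z - p‖ ^ 2) :
    (fun y => e.toEquiv.conj F y - e p - e.conjContinuousAlgEquiv D (y - e p))
      =O[𝓝 (e p)] fun y => ‖y - e p‖ ^ 2 := by
  have hlim : Tendsto e.symm (𝓝 (e p)) (𝓝 p) := by
    simpa using e.symm.continuous.tendsto (e p)
  have hsymm : (fun y => e.symm y - p) =O[𝓝 (e p)] fun y => y - e p :=
    ((e.symm : Y →L[ℝ] X).isBigO_comp (fun y => y - e p) _).congr_left fun y => by simp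
  have hcomp := ((e : X →L[ℝ] Y).isBigO_comp _ _).trans (hF.comp_tendsto hlim)
  exact (hcomp.trans (hsymm.norm_norm.pow 2)).congr_left fun y => by simp [Equiv.conj_apply]

end Conjugation

section Renorming

universe u

theorem isVonNBounded_setOf_apply_self_lt_one {X : Type*} [SeminormedAddCommGroup X]
    [NormedSpace ℝ X] {B : X →L[ℝ] X →L[ℝ] ℝ} (hB : IsCoercive B) :
    Bornology.IsVonNBounded ℝ {x | B x x < 1} := by
  obtain ⟨c, hc, hBc⟩ := hB
  refine NormedSpace.isVonNBounded_of_isBounded ℝ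
    (isBounded_iff_forall_norm_le.2 ⟨√c⁻¹, fun x (hx : B x x < 1) => ?_⟩)
  refine Real.le_sqrt_of_sq_le ?_
  rw [← one_div, le_div_iff₀' hc, sq, ← mul_assoc]
  exact (hBc x).trans hx.le

theorem exists_continuousLinearEquiv_inner_eq {X : Type u} [AddCommGroup X] [Module ℝ X]
    [TopologicalSpace X] [IsTopologicalAddGroup X] [ContinuousConstSMul ℝ X]
    (core : InnerProductSpace.Core ℝ X) (hcont : ContinuousAt (fun x => core.inner x x) 0)
    (hbdd : Bornology.IsVonNBounded ℝ {x | core.inner x x < 1}) :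
    ∃ (Z : Type u) (_ : NormedAddCommGroup Z) (_ : InnerProductSpace ℝ Z) (e : X ≃L[ℝ] Z),
      ∀ x y, ⟪e x, e y⟫ = core.inner x y :=
  ⟨X, core.toNormedAddCommGroupOfTopology hcont hbdd, .ofCoreOfTopology core hcont hbdd,
    .refl ℝ X, fun _ _ => rfl⟩

theorem exists_hilbert_renorming {X : Type u} [NormedAddCommGroup X] [NormedSpace ℝ X]
    [CompleteSpace X] {B : X →L[ℝ] X →L[ℝ] ℝ} (hsymm : ∀ x y, B x y = B y x)
    (hB : IsCoercive B) :
    ∃ (Z : Type u) (_ : NormedAddCommGroup Z) (_ : InnerProductSpace ℝ Z) (_ : CompleteSpace Z)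
      (e : X ≃L[ℝ] Z), ∀ x y, ⟪e x, e y⟫ = B x y := by
  obtain ⟨c, hc, hBc⟩ := id hB
  let core : InnerProductSpace.Core ℝ X :=
    { inner := fun x y => B x y
      conj_inner_symm := fun x y => hsymm y x
      re_inner_nonneg := fun x => (by positivity : 0 ≤ c * ‖x‖ * ‖x‖).trans (hBc x)
      add_left := fun x y z => by simp
      smul_left := fun x y r => by simp
      definite := fun x (hx : B x x = 0) => by
        by_contra hne
        have : 0 < c * ‖x‖ * ‖x‖ := by positivity
        exact (this.trans_le (hBc x)).ne' hx }
  obtain ⟨Z, _, _, e, he⟩ := exists_continuousLinearEquiv_inner_eq core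
    (by fun_prop : ContinuousAt (fun x => B x x) 0) (isVonNBounded_setOf_apply_self_lt_one hB)
  exact ⟨Z, _, _, (completeSpace_congr (e := e.toEquiv) e.isUniformEmbedding).1 ‹_›, e, he⟩

theorem isCoercive_of_symm_of_pos {X : Type*} [NormedAddCommGroup X] [NormedSpace ℝ X]
    (M : X ≃L[ℝ] StrongDual ℝ X) (hsymm : ∀ x y, M x y = M y x)
    (hpos : ∀ x, x ≠ 0 → 0 < M x x) : IsCoercive M.toContinuousLinearMap := by
  have hnonneg (x : X) : 0 ≤ M x x := by
    rcases eq_or_ne x 0 with rfl | hx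
    · simp
    · exact (hpos x hx).le
  set M' : X →L[ℝ] StrongDual ℝ X := M.toContinuousLinearMap
  set N : StrongDual ℝ X →L[ℝ] X := M.symm.toContinuousLinearMap
  have hcauchy (x y : X) : M x y ^ 2 ≤ M x x * M y y :=
    LinearMap.BilinForm.apply_sq_le_of_symm M'.toLinearMap₁₂ hnonneg ⟨hsymm⟩ x y
  have hdual (x : X) : ‖M x‖ ^ 2 ≤ M x x * ‖M'‖ := by
    have hM : ‖M x‖ ≤ √(M x x * ‖M'‖) := by
      refine opNorm_le_sqrt fun y => ?_
      rw [Real.norm_eq_abs, sq_abs]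
      calc M x y ^ 2 ≤ M x x * M y y := hcauchy x y
        _ ≤ M x x * (‖M'‖ * ‖y‖ * ‖y‖) := by
          gcongr
          · exact hnonneg x
          · exact (le_abs_self _).trans (M'.le_opNorm₂ y y)
        _ = M x x * ‖M'‖ * ‖y‖ ^ 2 := by ring
    exact (Real.le_sqrt (norm_nonneg _) (mul_nonneg (hnonneg x) (norm_nonneg M'))).1 hM
  refine ⟨(‖N‖ ^ 2 * ‖M'‖ + 1)⁻¹, by positivity, fun x => ?_⟩
  rw [mul_assoc, inv_mul_le_iff₀ (by positivity), ← sq]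
  calc ‖x‖ ^ 2 = ‖N (M x)‖ ^ 2 := by simp [N]
    _ ≤ (‖N‖ * ‖M x‖) ^ 2 := by gcongr; exact N.le_opNorm _
    _ ≤ ‖N‖ ^ 2 * (M x x * ‖M'‖) := by
      rw [mul_pow]
      gcongr
      exact hdual x
    _ ≤ (‖N‖ ^ 2 * ‖M'‖ + 1) * M x x := by linarith [hnonneg x]

theorem exists_hilbert_renorming_of_symm_of_pos {X : Type u} [NormedAddCommGroup X]
    [NormedSpace ℝ X] (M : X ≃L[ℝ] StrongDual ℝ X) (hsymm : ∀ x y, M x y = M y x)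
    (hpos : ∀ x, x ≠ 0 → 0 < M x x) :
    ∃ (Z : Type u) (_ : NormedAddCommGroup Z) (_ : InnerProductSpace ℝ Z) (_ : CompleteSpace Z)
      (e : X ≃L[ℝ] Z), ∀ x y, ⟪e x, e y⟫ = M x y :=
  have : CompleteSpace X :=
    (completeSpace_congr (e := M.toEquiv) M.isUniformEmbedding).2 inferInstance
  exists_hilbert_renorming hsymm (isCoercive_of_symm_of_pos M hsymm hpos)

end Renorming

section SecondOrder

variable {X Y W : Type*} [NormedAddCommGroup X] [NormedSpace ℝ X] [NormedAddCommGroup Y]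
  [NormedSpace ℝ Y] [NormedAddCommGroup W] [NormedSpace ℝ W] {p : X}

theorem isBigO_sub_fderiv_of_contDiffAt {f : X → W} (hf : ContDiffAt ℝ 2 f p) :
    (fun z => f z - f p - fderiv ℝ f p (z - p)) =O[𝓝 p] fun z => ‖z - p‖ ^ 2 := by
  obtain ⟨K, s, hs, hlip⟩ := (hf.fderiv_right (by norm_num)).exists_lipschitzOnWith
  have hdiff : ∀ᶠ z in 𝓝 p, DifferentiableAt ℝ f z :=
    (hf.eventually (by simp)).mono fun z hz => hz.differentiableAt two_ne_zero
  obtain ⟨ε, hε, hball⟩ := Metric.eventually_nhds_iff.1 (hdiff.and (eventually_mem_set.2 hs))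
  refine Asymptotics.IsBigO.of_bound K ?_
  filter_upwards [Metric.ball_mem_nhds p hε] with z hz
  have hmem {x : X} (hx : x ∈ Metric.closedBall p (dist z p)) : dist x p < ε :=
    (Metric.mem_closedBall.1 hx).trans_lt hz
  have hmean : ‖f z - f p - fderiv ℝ f p (z - p)‖ ≤ K * dist z p * ‖z - p‖ := by
    refine (convex_closedBall p (dist z p)).norm_image_sub_le_of_norm_hasFDerivWithin_le'
      (fun x hx => (hball (hmem hx)).1.hasFDerivAt.hasFDerivWithinAt) (fun x hx => ?_)
      (Metric.mem_closedBall_self dist_nonneg) (Metric.mem_closedBall.2 le_rfl)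
    rw [← dist_eq_norm]
    refine (hlip.dist_le_mul x (hball (hmem hx)).2 p (mem_of_mem_nhds hs)).trans ?_
    gcongr
    exact hx
  rw [Real.norm_of_nonneg (by positivity), sq, ← mul_assoc]
  rwa [dist_eq_norm] at hmean

variable {G : X → Y →L[ℝ] W} {r : X → Y}

theorem hasStrictFDerivAt_clm_apply_of_eq_zero {r' : X →L[ℝ] Y} (hG : ContDiffAt ℝ 1 G p)
    (hr : HasStrictFDerivAt r r' p) (hrp : r p = 0) :
    HasStrictFDerivAt (fun z => G z (r z)) (G p ∘L r') p := by
  refine ((hG.hasStrictFDerivAt one_ne_zero).clm_apply hr).congr_fderiv ?_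
  simp [hrp]

theorem isBigO_clm_apply_of_eq_zero (hG : ContDiffAt ℝ 1 G p) (hr : ContDiffAt ℝ 2 r p)
    (hrp : r p = 0) :
    (fun z => G z (r z) - (G p ∘L fderiv ℝ r p) (z - p)) =O[𝓝 p] fun z => ‖z - p‖ ^ 2 := by
  have hGsub : (fun z => G z - G p) =O[𝓝 p] fun z => z - p :=
    (hG.differentiableAt one_ne_zero).isBigO_sub
  have hrsub : r =O[𝓝 p] fun z => z - p := by
    simpa [hrp] using (hr.differentiableAt two_ne_zero).isBigO_sub
  have hvary : (fun z => (G z - G p) (r z)) =O[𝓝 p] fun z => ‖z - p‖ ^ 2 := by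
    have hmul : (fun z => ‖G z - G p‖ * ‖r z‖) =O[𝓝 p] fun z => ‖z - p‖ ^ 2 :=
      (hGsub.norm_norm.mul hrsub.norm_norm).congr_right fun z => (sq _).symm
    refine (Asymptotics.isBigO_of_le _ fun z => ?_).trans hmul
    rw [Real.norm_of_nonneg (by positivity)]
    exact (G z - G p).le_opNorm (r z)
  have hfrozen : (fun z => G p (r z - r p - fderiv ℝ r p (z - p))) =O[𝓝 p]
      fun z => ‖z - p‖ ^ 2 :=
    ((G p).isBigO_comp _ _).trans (isBigO_sub_fderiv_of_contDiffAt hr)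
  refine (hvary.add hfrozen).congr_left fun z => ?_
  simp [hrp]

end SecondOrder

section Iteration

variable {V : Type*} [NormedAddCommGroup V] [InnerProductSpace ℝ V]
  {H : Type*} [NormedAddCommGroup H] [InnerProductSpace ℝ H]

/-- The preconditioned residual `M⁻¹ L₀ u`, as a function of `z = (u, μ)`. -/
noncomputable def residual (M : V ≃L[ℝ] StrongDual ℝ V) (ι : V →L[ℝ] H)
    (L00 : V → StrongDual ℝ V) (z : V × ℝ) : V :=
  M.symm (L0 ι L00 z.2 z.1)

/-- The operator `w ↦ (-M⁻¹ L₁† w, ⟨u, w⟩)` at `z = (u, μ)`, through which the residual enters one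
step of the iteration. -/
noncomputable def feedback (M : V ≃L[ℝ] StrongDual ℝ V) (ι : V →L[ℝ] H)
    (L00 : V → StrongDual ℝ V) (z : V × ℝ) : V →L[ℝ] V × ℝ :=
  (-(M.symm.toContinuousLinearMap ∘L L1adj ι L00 z.2 z.1)).prod (toDual ι z.1)

variable {M : V ≃L[ℝ] StrongDual ℝ V} {ι : V →L[ℝ] H} {L00 : V → StrongDual ℝ V} {u : V} {μ : ℝ}

theorem toDual_apply (v w : V) : toDual ι v w = ⟪ι v, ι w⟫ := rfl

theorem L1adj_apply (v w : V) : L1adj ι L00 μ u v w = L1 ι L00 μ u w v := rfl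

theorem linResidual_apply (z : V × ℝ) :
    linResidual ι L00 μ u z = L1 ι L00 μ u z.1 - z.2 • toDual ι u := rfl

theorem L1_eq_fderiv_sub {v : V} (h : DifferentiableAt ℝ L00 v) (ν : ℝ) :
    L1 ι L00 ν v = fderiv ℝ L00 v - ν • toDual ι :=
  (h.hasFDerivAt.sub ((toDual ι).hasFDerivAt.const_smul ν)).fderiv

theorem residual_eq_zero {z : V × ℝ} (hz : L0 ι L00 z.2 z.1 = 0) : residual M ι L00 z = 0 := by
  rw [residual, hz, map_zero]

theorem step_eq_add_feedback (Δt : ℝ) (z : V × ℝ) :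
    step M ι L00 Δt z = z + Δt • feedback M ι L00 z (residual M ι L00 z) := by
  ext
  · simp [step, feedback, residual, sub_eq_add_neg]
  · simp [step, feedback, residual, toDual_apply]

theorem step_eq_self (Δt : ℝ) {z : V × ℝ} (hz : L0 ι L00 z.2 z.1 = 0) :
    step M ι L00 Δt z = z := by
  rw [step_eq_add_feedback, residual_eq_zero hz, map_zero, smul_zero, add_zero]

theorem augmented_eq_feedback_comp :
    augmented M ι L00 μ u = feedback M ι L00 (u, μ) ∘L
      (M.symm.toContinuousLinearMap ∘L linResidual ι L00 μ u) := rfl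

theorem contDiffAt_residual (hsmooth : ContDiffAt ℝ 2 L00 u) :
    ContDiffAt ℝ 2 (residual M ι L00) (u, μ) := by
  have hL00 : ContDiffAt ℝ 2 (fun z : V × ℝ => L00 z.1) (u, μ) := hsmooth.comp _ contDiffAt_fst
  have hL0 : ContDiffAt ℝ 2 (fun z : V × ℝ => L0 ι L00 z.2 z.1) (u, μ) :=
    hL00.sub (by fun_prop)
  exact M.symm.contDiff.contDiffAt.comp (u, μ) hL0

theorem contDiffAt_L1 (hsmooth : ContDiffAt ℝ 2 L00 u) :
    ContDiffAt ℝ 1 (fun z : V × ℝ => L1 ι L00 z.2 z.1) (u, μ) := by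
  have hderiv : ContDiffAt ℝ 1 (fun z : V × ℝ => fderiv ℝ L00 z.1) (u, μ) :=
    (hsmooth.fderiv_right (by norm_num)).comp _ contDiffAt_fst
  have hdiff : ∀ᶠ v in 𝓝 u, DifferentiableAt ℝ L00 v :=
    (hsmooth.eventually (by simp)).mono fun v hv => hv.differentiableAt two_ne_zero
  have hsmul : ContDiffAt ℝ 1 ((ContinuousLinearMap.snd ℝ V ℝ).smulRight (toDual ι)) (u, μ) :=
    (ContinuousLinearMap.contDiff _).contDiffAt
  refine ContDiffAt.congr_of_eventuallyEq (hderiv.sub hsmul) ?_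
  exact (continuousAt_fst.eventually hdiff).mono fun z hz => L1_eq_fderiv_sub hz z.2

theorem contDiffAt_feedback (hsmooth : ContDiffAt ℝ 2 L00 u) :
    ContDiffAt ℝ 1 (feedback M ι L00) (u, μ) := by
  have hflip : ContDiff ℝ 1 (ContinuousLinearMap.flipₗᵢ ℝ V V ℝ) :=
    LinearIsometryEquiv.contDiff _
  have hadj : ContDiffAt ℝ 1 (fun z : V × ℝ => L1adj ι L00 z.2 z.1) (u, μ) :=
    hflip.contDiffAt.comp (u, μ) (contDiffAt_L1 hsmooth)
  have hfst : ContDiffAt ℝ 1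
      (fun z : V × ℝ => -(M.symm.toContinuousLinearMap ∘L L1adj ι L00 z.2 z.1)) (u, μ) :=
    (contDiffAt_const.clm_comp hadj).neg
  have hsnd : ContDiffAt ℝ 1 (fun z : V × ℝ => toDual ι z.1) (u, μ) := by fun_prop
  have hprod : ContDiff ℝ 1
      (ContinuousLinearMap.prodₗᵢ ℝ : (V →L[ℝ] V) × StrongDual ℝ V ≃ₗᵢ[ℝ] V →L[ℝ] V × ℝ) :=
    LinearIsometryEquiv.contDiff _
  exact hprod.contDiffAt.comp (u, μ) (hfst.prodMk hsnd)

theorem hasStrictFDerivAt_residual (hsmooth : ContDiffAt ℝ 2 L00 u) :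
    HasStrictFDerivAt (residual M ι L00)
      (M.symm.toContinuousLinearMap ∘L linResidual ι L00 μ u) (u, μ) := by
  have hd : DifferentiableAt ℝ L00 u := hsmooth.differentiableAt two_ne_zero
  have hL00 : HasStrictFDerivAt (fun z : V × ℝ => L00 z.1)
      (fderiv ℝ L00 u ∘L ContinuousLinearMap.fst ℝ V ℝ) (u, μ) :=
    (hsmooth.hasStrictFDerivAt two_ne_zero).comp (u, μ) hasStrictFDerivAt_fst
  have hdual : HasStrictFDerivAt (fun z : V × ℝ => toDual ι z.1)
      (toDual ι ∘L ContinuousLinearMap.fst ℝ V ℝ) (u, μ) :=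
    (toDual ι).hasStrictFDerivAt.comp (u, μ) hasStrictFDerivAt_fst
  have hL0 := hL00.sub ((hasStrictFDerivAt_snd (p := (u, μ))).smul hdual)
  refine (M.symm.toContinuousLinearMap.hasStrictFDerivAt.comp (u, μ) hL0).congr_fderiv ?_
  congr 1
  ext z <;> simp [linResidual_apply, L1_eq_fderiv_sub hd]

theorem hasStrictFDerivAt_step (hsmooth : ContDiffAt ℝ 2 L00 u) (hsol : L0 ι L00 μ u = 0)
    (Δt : ℝ) :
    HasStrictFDerivAt (step M ι L00 Δt) (1 + Δt • augmented M ι L00 μ u) (u, μ) := by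
  have h := hasStrictFDerivAt_clm_apply_of_eq_zero
    (contDiffAt_feedback (M := M) (ι := ι) (μ := μ) hsmooth)
    (hasStrictFDerivAt_residual (M := M) hsmooth) (residual_eq_zero (z := (u, μ)) hsol)
  exact ((hasStrictFDerivAt_id (u, μ)).add (h.const_smul Δt)).congr_of_eventuallyEq
    (Eventually.of_forall fun z => (step_eq_add_feedback Δt z).symm)

theorem isBigO_step (hsmooth : ContDiffAt ℝ 2 L00 u) (hsol : L0 ι L00 μ u = 0) (Δt : ℝ) :
    (fun z => step M ι L00 Δt z - (u, μ) - (1 + Δt • augmented M ι L00 μ u) (z - (u, μ)))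
      =O[𝓝 (u, μ)] fun z => ‖z - (u, μ)‖ ^ 2 := by
  have h := isBigO_clm_apply_of_eq_zero
    (contDiffAt_feedback (M := M) (ι := ι) (μ := μ) hsmooth)
    (contDiffAt_residual (M := M) hsmooth) (residual_eq_zero (z := (u, μ)) hsol)
  rw [(hasStrictFDerivAt_residual hsmooth).hasFDerivAt.fderiv] at h
  refine (h.const_smul_left Δt).congr_left fun z => ?_
  rw [step_eq_add_feedback, augmented_eq_feedback_comp, add_apply, one_apply_eq_self, smul_apply,
    Pi.smul_apply, smul_sub]
  abel

end Iteration

section EnergyCoordinates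

variable {V : Type*} [NormedAddCommGroup V] [InnerProductSpace ℝ V]
  {H : Type*} [NormedAddCommGroup H] [InnerProductSpace ℝ H]
  {Z : Type*} [NormedAddCommGroup Z] [InnerProductSpace ℝ Z]

/-- Coordinates on `V × ℝ` in which the squared norm of `(v, ν)` is `⟨M v, v⟩ + ν²`, built from
coordinates `e` on `V` in which the squared norm of `v` is `⟨M v, v⟩`. -/
noncomputable def energyEquiv (e : V ≃L[ℝ] Z) : (V × ℝ) ≃L[ℝ] WithLp 2 (Z × ℝ) :=
  (e.prodCongr (.refl ℝ ℝ)).trans (WithLp.prodContinuousLinearEquiv 2 ℝ Z ℝ).symm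

/-- The preconditioned linearized residual `(ũ, μ̃) ↦ M⁻¹ (L₁ ũ - μ̃ u)`, read in the coordinates
`energyEquiv e` on `V × ℝ` and `e` on `V`. -/
noncomputable def energyResidual (e : V ≃L[ℝ] Z) (M : V ≃L[ℝ] StrongDual ℝ V) (ι : V →L[ℝ] H)
    (L00 : V → StrongDual ℝ V) (μ : ℝ) (u : V) : WithLp 2 (Z × ℝ) →L[ℝ] Z :=
  e.toContinuousLinearMap ∘L M.symm.toContinuousLinearMap ∘L linResidual ι L00 μ u ∘L
    (energyEquiv e).symm.toContinuousLinearMap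

variable {e : V ≃L[ℝ] Z} {M : V ≃L[ℝ] StrongDual ℝ V} {ι : V →L[ℝ] H}
  {L00 : V → StrongDual ℝ V} {u : V} {μ : ℝ}

theorem inner_energyEquiv (z w : V × ℝ) :
    ⟪energyEquiv e z, energyEquiv e w⟫ = ⟪e z.1, e w.1⟫ + z.2 * w.2 := by
  simp [energyEquiv, WithLp.prod_inner_apply, mul_comm]

theorem energyResidual_energyEquiv (z : V × ℝ) :
    energyResidual e M ι L00 μ u (energyEquiv e z) = e (M.symm (linResidual ι L00 μ u z)) := by
  simp [energyResidual]

theorem inner_energyEquiv_augmented (he : ∀ v w, ⟪e v, e w⟫ = M v w) (z w : V × ℝ) :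
    ⟪energyEquiv e (augmented M ι L00 μ u z), energyEquiv e w⟫ =
      -⟪energyResidual e M ι L00 μ u (energyEquiv e z),
        energyResidual e M ι L00 μ u (energyEquiv e w)⟫ := by
  set r := M.symm (linResidual ι L00 μ u z) with hr
  have haug : augmented M ι L00 μ u z = (-M.symm (L1adj ι L00 μ u r), toDual ι u r) := rfl
  rw [real_inner_comm (energyResidual e M ι L00 μ u _), energyResidual_energyEquiv,
    energyResidual_energyEquiv, ← hr, inner_energyEquiv, haug, he, he, map_neg,
    M.apply_symm_apply, M.apply_symm_apply, linResidual_apply, neg_apply, L1adj_apply, sub_apply,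
    smul_apply, smul_eq_mul]
  ring

theorem conj_augmented [CompleteSpace Z] (he : ∀ v w, ⟪e v, e w⟫ = M v w) :
    (energyEquiv e).conjContinuousAlgEquiv (augmented M ι L00 μ u) =
      -((energyResidual e M ι L00 μ u)† ∘L energyResidual e M ι L00 μ u) := by
  refine ContinuousLinearMap.ext fun x => ext_inner_right ℝ fun y => ?_
  obtain ⟨z, rfl⟩ := (energyEquiv e).surjective x
  obtain ⟨w, rfl⟩ := (energyEquiv e).surjective y
  rw [neg_apply, inner_neg_left, ContinuousLinearMap.comp_apply,
    ContinuousLinearMap.adjoint_inner_left, ← inner_energyEquiv_augmented he]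
  simp

theorem conj_one_add_smul_augmented [CompleteSpace Z] (he : ∀ v w, ⟪e v, e w⟫ = M v w) (t : ℝ) :
    (energyEquiv e).conjContinuousAlgEquiv (1 + t • augmented M ι L00 μ u) =
      1 - t • ((energyResidual e M ι L00 μ u)† ∘L energyResidual e M ι L00 μ u) := by
  rw [map_add, map_one, map_smul, conj_augmented he, smul_neg, sub_eq_add_neg]

theorem spectrum_augmented [CompleteSpace Z] (he : ∀ v w, ⟪e v, e w⟫ = M v w) :
    spectrum ℝ (augmented M ι L00 μ u) =
      spectrum ℝ (-((energyResidual e M ι L00 μ u)† ∘L energyResidual e M ι L00 μ u)) := by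
  rw [← conj_augmented he, AlgEquiv.spectrum_eq]

theorem hasStrictFDerivAt_conj_step [CompleteSpace Z] (he : ∀ v w, ⟪e v, e w⟫ = M v w)
    (hsmooth : ContDiffAt ℝ 2 L00 u) (hsol : L0 ι L00 μ u = 0) (Δt : ℝ) :
    HasStrictFDerivAt ((energyEquiv e).toEquiv.conj (step M ι L00 Δt))
      (1 - Δt • ((energyResidual e M ι L00 μ u)† ∘L energyResidual e M ι L00 μ u))
      (energyEquiv e (u, μ)) := by
  rw [← conj_one_add_smul_augmented he]
  exact hasStrictFDerivAt_conj _ (hasStrictFDerivAt_step hsmooth hsol Δt)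

end EnergyCoordinates

section Linearization

variable {V : Type*} [NormedAddCommGroup V] [InnerProductSpace ℝ V]
  {H : Type*} [NormedAddCommGroup H] [InnerProductSpace ℝ H]
  {Z : Type*} [NormedAddCommGroup Z] [InnerProductSpace ℝ Z]
  {e : V ≃L[ℝ] Z} {M : V ≃L[ℝ] StrongDual ℝ V} {ι : V →L[ℝ] H}
  {L00 : V → StrongDual ℝ V} {u : V} {μ : ℝ}

theorem not_exists_L1_eq_toDual (h : ∃ φ : V, L1adj ι L00 μ u φ = 0 ∧ ⟪ι u, ι φ⟫ ≠ 0) :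
    ¬ ∃ F : V, L1 ι L00 μ u F = toDual ι u := by
  rintro ⟨F, hF⟩
  obtain ⟨φ, hφ, hne⟩ := h
  rw [← toDual_apply, ← hF, ← L1adj_apply, hφ] at hne
  exact hne rfl

theorem linResidual_eq_zero_iff (hF : ¬ ∃ F : V, L1 ι L00 μ u F = toDual ι u) {z : V × ℝ} :
    linResidual ι L00 μ u z = 0 ↔ L1 ι L00 μ u z.1 = 0 ∧ z.2 = 0 := by
  rw [linResidual_apply]
  refine ⟨fun h => ?_, fun h => by rw [h.1, h.2, zero_smul, sub_zero]⟩
  have hz : z.2 = 0 := by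
    by_contra hne
    exact hF ⟨z.2⁻¹ • z.1, by rw [map_smul, sub_eq_zero.1 h, inv_smul_smul₀ hne]⟩
  exact ⟨by rwa [hz, zero_smul, sub_zero] at h, hz⟩

theorem energyResidual_energyEquiv_eq_zero_iff
    (hF : ¬ ∃ F : V, L1 ι L00 μ u F = toDual ι u) {z : V × ℝ} :
    energyResidual e M ι L00 μ u (energyEquiv e z) = 0 ↔ L1 ι L00 μ u z.1 = 0 ∧ z.2 = 0 := by
  rw [energyResidual_energyEquiv, EmbeddingLike.map_eq_zero_iff, EmbeddingLike.map_eq_zero_iff,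
    linResidual_eq_zero_iff hF]

theorem energyResidual_ne_zero (hF : ¬ ∃ F : V, L1 ι L00 μ u F = toDual ι u) :
    energyResidual e M ι L00 μ u ≠ 0 := by
  intro h
  have hz : energyResidual e M ι L00 μ u (energyEquiv e (0, 1)) = 0 := by rw [h, zero_apply]
  exact one_ne_zero ((energyResidual_energyEquiv_eq_zero_iff hF).1 hz).2

theorem isClosed_range_linResidual (h : IsClosed (Set.range (L1 ι L00 μ u))) :
    IsClosed (Set.range (linResidual ι L00 μ u)) := by
  have hL1 : IsClosed ((L1 ι L00 μ u).range : Set (StrongDual ℝ V)) := by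
    rwa [LinearMap.coe_range]
  have hsup : (linResidual ι L00 μ u).range =
      (L1 ι L00 μ u).range ⊔ Submodule.span ℝ {toDual ι u} := by
    ext f
    simp only [Submodule.mem_sup, Submodule.mem_span_singleton, LinearMap.mem_range]
    constructor
    · rintro ⟨z, rfl⟩
      exact ⟨_, ⟨z.1, rfl⟩, _, ⟨-z.2, rfl⟩, by simp [linResidual_apply, sub_eq_add_neg]⟩
    · rintro ⟨_, ⟨v, rfl⟩, _, ⟨ν, rfl⟩, rfl⟩
      exact ⟨(v, -ν), by
        ext w
        simp [linResidual_apply]⟩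
  have hclosed := Submodule.isClosed_sup_finiteDimensional _ (Submodule.span ℝ {toDual ι u}) hL1
  rwa [← hsup, LinearMap.coe_range] at hclosed

theorem isClosed_range_energyResidual (h : IsClosed (Set.range (L1 ι L00 μ u))) :
    IsClosed (Set.range (energyResidual e M ι L00 μ u)) := by
  have hrange : Set.range (energyResidual e M ι L00 μ u) =
      (M.symm.trans e) '' Set.range (linResidual ι L00 μ u) := by
    rw [← Set.range_comp, ← (energyEquiv e).surjective.range_comp]
    exact congrArg Set.range (funext energyResidual_energyEquiv)
  rw [hrange]
  exact (M.symm.trans e).toHomeomorph.isClosedMap _ (isClosed_range_linResidual h)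

theorem range_eq_span_single {W : Type*} [NormedAddCommGroup W] [NormedSpace ℝ W] {s : ℕ}
    (A : EuclideanSpace ℝ (Fin s) →L[ℝ] W) :
    A.range = Submodule.span ℝ (Set.range fun j : Fin s => A (EuclideanSpace.single j 1)) := by
  rw [LinearMap.range_eq_map, ← (EuclideanSpace.basisFun (Fin s) ℝ).toBasis.span_eq,
    Submodule.map_span, ← Set.range_comp]
  congr 2
  ext j
  simp

theorem ker_energyResidual_le (hF : ¬ ∃ F : V, L1 ι L00 μ u F = toDual ι u) {s : ℕ}
    {U : EuclideanSpace ℝ (Fin s) → V} {c₀ : EuclideanSpace ℝ (Fin s)}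
    (hker : KernelOnlyInvarianceModes ι L00 μ u U c₀) :
    (energyResidual e M ι L00 μ u).ker ≤
      ((energyEquiv e).toContinuousLinearMap ∘L (fderiv ℝ U c₀).prod 0).range := by
  intro y hy
  obtain ⟨z, rfl⟩ := (energyEquiv e).surjective y
  obtain ⟨hL1, hz⟩ := (energyResidual_energyEquiv_eq_zero_iff hF).1 hy
  have hmode : z.1 ∈ (fderiv ℝ U c₀).range := by
    rw [range_eq_span_single, ← hker.kernel]
    exact hL1
  obtain ⟨a, ha⟩ := hmode
  exact ⟨a, congrArg (energyEquiv e) (Prod.ext ha hz.symm)⟩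

end Linearization

section Stability

variable {V : Type*} [NormedAddCommGroup V] [InnerProductSpace ℝ V]
  {H : Type*} [NormedAddCommGroup H] [InnerProductSpace ℝ H]
  {Z : Type*} [NormedAddCommGroup Z] [InnerProductSpace ℝ Z] [CompleteSpace Z]
  {e : V ≃L[ℝ] Z} {M : V ≃L[ℝ] StrongDual ℝ V} {ι : V →L[ℝ] H}
  {L00 : V → StrongDual ℝ V} {u : V} {μ Δt : ℝ}

theorem isLeast_spectrum_augmented (he : ∀ v w, ⟪e v, e w⟫ = M v w)
    (hF : ¬ ∃ F : V, L1 ι L00 μ u F = toDual ι u) :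
    IsLeast (spectrum ℝ (augmented M ι L00 μ u)) (-‖energyResidual e M ι L00 μ u‖ ^ 2) := by
  rw [spectrum_augmented he]
  exact isLeast_spectrum_neg_adjoint_comp_self (energyResidual_ne_zero hF)

theorem eventually_exists_tendsto_iterate_step (he : ∀ v w, ⟪e v, e w⟫ = M v w)
    (hsmooth : ContDiffAt ℝ 2 L00 u) (hsol : L0 ι L00 μ u = 0)
    (hF : ¬ ∃ F : V, L1 ι L00 μ u F = toDual ι u) {s : ℕ}
    {U : EuclideanSpace ℝ (Fin s) → V} {c₀ : EuclideanSpace ℝ (Fin s)}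
    (hker : KernelOnlyInvarianceModes ι L00 μ u U c₀)
    (hclosed : IsClosed (Set.range (L1 ι L00 μ u))) (hΔt : 0 < Δt)
    (hsmall : Δt * ‖energyResidual e M ι L00 μ u‖ ^ 2 < 2)
    {N : Set (EuclideanSpace ℝ (Fin s))} (hN : N ∈ 𝓝 c₀) :
    ∀ᶠ z in 𝓝 (u, μ), ∃ c ∈ N,
      Tendsto (fun n : ℕ => (step M ι L00 Δt)^[n] z) atTop (𝓝 (U c, μ)) := by
  obtain rfl := hker.base
  have hΦ : HasStrictFDerivAt (fun c => energyEquiv e (U c, μ))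
      ((energyEquiv e).toContinuousLinearMap ∘L (fderiv ℝ U c₀).prod 0) c₀ :=
    (energyEquiv e).toContinuousLinearMap.hasStrictFDerivAt.comp c₀
      ((hker.smooth.hasStrictFDerivAt one_ne_zero).prodMk (hasStrictFDerivAt_const μ c₀))
  have hfix : ∀ᶠ c in 𝓝 c₀, (energyEquiv e).toEquiv.conj (step M ι L00 Δt)
      (energyEquiv e (U c, μ)) = energyEquiv e (U c, μ) :=
    hker.solution.mono fun c hc => by simp [Equiv.conj_apply, step_eq_self Δt (z := (U c, μ)) hc]
  have hlim := eventually_exists_tendsto_iterate_of_adjoint_comp_self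
    (Φ := fun c => energyEquiv e (U c, μ)) (isClosed_range_energyResidual hclosed) hΔt
    hsmall (hasStrictFDerivAt_conj_step he hsmooth hsol Δt) hΦ hfix
    (ker_energyResidual_le hF hker) hN
  filter_upwards [((energyEquiv e).continuous.tendsto _).eventually hlim] with z ⟨c, hc, hz⟩
  refine ⟨c, hc, (energyEquiv e).toHomeomorph.isInducing.tendsto_nhds_iff.2 (hz.congr fun n => ?_)⟩
  exact iterate_conj_apply (energyEquiv e).toEquiv _ n z

theorem exists_mem_closure_setOf_dist_iterate_step (he : ∀ v w, ⟪e v, e w⟫ = M v w)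
    (hsmooth : ContDiffAt ℝ 2 L00 u) (hsol : L0 ι L00 μ u = 0) (hΔt : 0 ≤ Δt)
    (hlarge : 2 < Δt * ‖energyResidual e M ι L00 μ u‖ ^ 2) :
    ∃ ε > 0, (u, μ) ∈
      closure {z : V × ℝ | ∃ n : ℕ, ε ≤ dist ((step M ι L00 Δt)^[n] z) (u, μ)} := by
  have hstep := isBigO_conj (energyEquiv e) (isBigO_step (M := M) hsmooth hsol Δt)
  rw [conj_one_add_smul_augmented he] at hstep
  obtain ⟨W, hW, hmem⟩ := exists_mem_closure_escapeSet_of_adjoint_comp_self hΔt hlarge hstep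
  obtain ⟨ε, hε, hsub⟩ := exists_escapeSet_subset_setOf_dist
    ((energyEquiv e).continuous.continuousAt.preimage_mem_nhds hW) (step M ι L00 Δt)
  refine ⟨ε, hε, closure_mono hsub ?_⟩
  change _ ∈ closure (escapeSet _ ((energyEquiv e).toEquiv ⁻¹' W))
  rw [← preimage_escapeSet_conj]
  exact (energyEquiv e).toHomeomorph.preimage_closure _ ▸ hmem

theorem exists_dense_setOf_dist_iterate_step (he : ∀ v w, ⟪e v, e w⟫ = M v w)
    (hsmooth : ContDiffAt ℝ 2 L00 u) (hsol : L0 ι L00 μ u = 0) (hΔt : 0 < Δt) {ν : ℝ}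
    (hν : -‖energyResidual e M ι L00 μ u‖ ^ 2 < ν) (hνΔt : ν ≤ -2 / Δt)
    (hspec : ν ∉ spectrum ℝ (augmented M ι L00 μ u)) :
    ∃ ε > 0, Dense {z : V × ℝ | ∃ n : ℕ, ε ≤ dist ((step M ι L00 Δt)^[n] z) (u, μ)} := by
  rw [spectrum_augmented he, ← spectrum.neg_eq, Set.mem_neg] at hspec
  rw [le_div_iff₀ hΔt] at hνΔt
  obtain ⟨W, hW, hdense⟩ := exists_dense_escapeSet_of_adjoint_comp_self hΔt (a := -ν)
    (by linarith) (by linarith) hspec (hasStrictFDerivAt_conj_step he hsmooth hsol Δt)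
  obtain ⟨ε, hε, hsub⟩ := exists_escapeSet_subset_setOf_dist
    ((energyEquiv e).continuous.continuousAt.preimage_mem_nhds hW) (step M ι L00 Δt)
  refine ⟨ε, hε, Dense.mono hsub ?_⟩
  have hpre := hdense.preimage (energyEquiv e).toHomeomorph.isOpenMap
  exact preimage_escapeSet_conj (energyEquiv e).toEquiv _ W ▸ hpre

end Stability

end SOMI

theorem mainTheorem7_general
    {V : Type*} [NormedAddCommGroup V] [InnerProductSpace ℝ V]
    {H : Type*} [NormedAddCommGroup H] [InnerProductSpace ℝ H]
    (ι : V →L[ℝ] H)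
    (M : V ≃L[ℝ] StrongDual ℝ V) (hMsymm : ∀ v w, M v w = M w v)
    (hMpos : ∀ v, v ≠ 0 → 0 < M v v)
    (L00 : V → StrongDual ℝ V) (u : V) (μ : ℝ)
    (hsmooth : ContDiffAt ℝ 2 L00 u) (hsol : SOMI.L0 ι L00 μ u = 0)
    {s : ℕ} (U : EuclideanSpace ℝ (Fin s) → V) (c₀ : EuclideanSpace ℝ (Fin s))
    (hker : SOMI.KernelOnlyInvarianceModes ι L00 μ u U c₀)
    (hnonorth : ∃ φ : V, SOMI.L1adj ι L00 μ u φ = 0 ∧ ⟪ι u, ι φ⟫ ≠ 0) :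
    (¬ ∃ F : V, SOMI.L1 ι L00 μ u F = SOMI.toDual ι u) ∧
    ∃ Λ : ℝ, IsLeast (spectrum ℝ (SOMI.augmented M ι L00 μ u)) Λ ∧ Λ < 0 ∧
      (IsClosed (Set.range (SOMI.L1 ι L00 μ u)) →
        ∀ Δt : ℝ, 0 < Δt → Δt < -2 / Λ →
          ∀ ε > 0, ∃ δ > 0, ∀ z₀ : V × ℝ, dist z₀ (u, μ) < δ →
            ∃ c : EuclideanSpace ℝ (Fin s), dist c c₀ < ε ∧ SOMI.L0 ι L00 μ (U c) = 0 ∧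
              Tendsto (fun n : ℕ => (SOMI.step M ι L00 Δt)^[n] z₀) atTop (𝓝 (U c, μ))) ∧
      (∀ Δt : ℝ, -2 / Λ < Δt →
        (∃ ε > 0, ∀ δ > 0, ∃ z₀ : V × ℝ, dist z₀ (u, μ) < δ ∧
          ∃ n : ℕ, ε ≤ dist ((SOMI.step M ι L00 Δt)^[n] z₀) (u, μ)) ∧
        ((∃ ν : ℝ, Λ < ν ∧ ν ≤ -2 / Δt ∧ ν ∉ spectrum ℝ (SOMI.augmented M ι L00 μ u)) →
          ∃ ε > 0, Dense {z₀ : V × ℝ |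
            ∃ n : ℕ, ε ≤ dist ((SOMI.step M ι L00 Δt)^[n] z₀) (u, μ)})) := by
  have hF := SOMI.not_exists_L1_eq_toDual hnonorth
  obtain ⟨Z, _, _, _, e, he⟩ := SOMI.exists_hilbert_renorming_of_symm_of_pos M hMsymm hMpos
  have hnorm : 0 < ‖SOMI.energyResidual e M ι L00 μ u‖ :=
    (norm_pos_iff (a := SOMI.energyResidual e M ι L00 μ u)).2 (SOMI.energyResidual_ne_zero hF)
  have hrpos := pow_pos hnorm 2
  refine ⟨hF, _, SOMI.isLeast_spectrum_augmented he hF, neg_neg_of_pos hrpos, ?_, ?_⟩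
  · intro hclosed Δt hΔt hsmall ε hε
    rw [neg_div_neg_eq, lt_div_iff₀ hrpos] at hsmall
    obtain ⟨δ, hδ, hlim⟩ := Metric.eventually_nhds_iff.1
      (SOMI.eventually_exists_tendsto_iterate_step he hsmooth hsol hF hker hclosed hΔt hsmall
        (inter_mem (Metric.ball_mem_nhds c₀ hε) hker.solution))
    exact ⟨δ, hδ, fun z₀ hz₀ =>
      let ⟨c, ⟨hcε, hcsol⟩, hc⟩ := hlim hz₀
      ⟨c, hcε, hcsol, hc⟩⟩
  · intro Δt hlarge
    rw [neg_div_neg_eq] at hlarge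
    have hΔt : 0 < Δt := (div_pos two_pos hrpos).trans hlarge
    rw [div_lt_iff₀ hrpos] at hlarge
    refine ⟨?_, fun ⟨ν, hν, hνΔt, hspec⟩ =>
      SOMI.exists_dense_setOf_dist_iterate_step he hsmooth hsol hΔt hν hνΔt hspec⟩
    obtain ⟨ε, hε, hmem⟩ :=
      SOMI.exists_mem_closure_setOf_dist_iterate_step he hsmooth hsol hΔt.le hlarge
    refine ⟨ε, hε, fun δ hδ => ?_⟩
    obtain ⟨z₀, hescape, hdist⟩ := Metric.mem_closure_iff.1 hmem δ hδ
    exact ⟨z₀, by rwa [dist_comm], hescape⟩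

theorem mainTheorem7
    {V : Type*} [NormedAddCommGroup V] [InnerProductSpace ℝ V] [CompleteSpace V]
    {H : Type*} [NormedAddCommGroup H] [InnerProductSpace ℝ H] [CompleteSpace H]
    -- the dense inclusion of the energy space
    (ι : V →L[ℝ] H) (hι : Function.Injective ι) (hdense : DenseRange ι)
    -- the Hermitian positive-definite acceleration operator
    (M : V ≃L[ℝ] StrongDual ℝ V) (hMsymm : ∀ v w, M v w = M w v)
    (hMpos : ∀ v, v ≠ 0 → 0 < M v v)
    -- the solitary wave and its propagation constant
    (L00 : V → StrongDual ℝ V) (u : V) (μ : ℝ)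
    (hsmooth : ContDiffAt ℝ 2 L00 u) (hsol : SOMI.L0 ι L00 μ u = 0)
    -- the kernel of the linearization consists of invariance modes
    {s : ℕ} (U : EuclideanSpace ℝ (Fin s) → V) (c₀ : EuclideanSpace ℝ (Fin s))
    (hker : SOMI.KernelOnlyInvarianceModes ι L00 μ u U c₀)
    -- the wave is not orthogonal to the kernel of the adjoint linearization
    (hnonorth : ∃ φ : V, SOMI.L1adj ι L00 μ u φ = 0 ∧ ⟪ι u, ι φ⟫ ≠ 0) :
    (¬ ∃ F : V, SOMI.L1 ι L00 μ u F = SOMI.toDual ι u) ∧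
    ∃ Λ : ℝ, IsLeast (spectrum ℝ (SOMI.augmented M ι L00 μ u)) Λ ∧ Λ < 0 ∧
      -- convergence
      (IsClosed (Set.range (SOMI.L1 ι L00 μ u)) →
        ∀ Δt : ℝ, 0 < Δt → Δt < -2 / Λ →
          ∀ ε > 0, ∃ δ > 0, ∀ z₀ : V × ℝ, dist z₀ (u, μ) < δ →
            ∃ c : EuclideanSpace ℝ (Fin s), dist c c₀ < ε ∧ SOMI.L0 ι L00 μ (U c) = 0 ∧
              Tendsto (fun n : ℕ => (SOMI.step M ι L00 Δt)^[n] z₀) atTop (𝓝 (U c, μ))) ∧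
      -- divergence
      (∀ Δt : ℝ, -2 / Λ < Δt →
        (∃ ε > 0, ∀ δ > 0, ∃ z₀ : V × ℝ, dist z₀ (u, μ) < δ ∧
          ∃ n : ℕ, ε ≤ dist ((SOMI.step M ι L00 Δt)^[n] z₀) (u, μ)) ∧
        ((∃ ν : ℝ, Λ < ν ∧ ν ≤ -2 / Δt ∧ ν ∉ spectrum ℝ (SOMI.augmented M ι L00 μ u)) →
          ∃ ε > 0, Dense {z₀ : V × ℝ |
            ∃ n : ℕ, ε ≤ dist ((SOMI.step M ι L00 Δt)^[n] z₀) (u, μ)})) :=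
  mainTheorem7_general ι M hMsymm hMpos L00 u μ hsmooth hsol U c₀ hker hnonorth
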